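/- **Setting.** A firm has $m>0$ units of a divisible resource. An arrival sequence $I=(s_t,z_t)_{t\le T}$ (of any finite length, unknown to the firm) consists of requests of size $s_t>0$ and type $z_t\in\{\ell,h\}$; one unit allocated to a type-$z$ request earns $r_z$, where $0<r_\ell<r_h$. On the arrival of request $t$ an online algorithm, knowing only the requests so far, irrevocably allocates $a_t\in[0,s_t]$ to it, with $\sum_t a_t\le m$. A randomized online algorithm is a random choice of a deterministic one. $\mathrm{rew}(\mathcal A,I)$ is the expected total reward and $\mathrm{opt}(I)$ is the maximal reward of an allocation made with full knowledge of $I$. Let $\ell(I)$, $h(I)$ be the total low- and high-reward demand. The ML region $\mathcal R\subset[0,\infty)^2$ is a nonempty compact convex set, and $$\mathrm{consis}(\mathcal A)=\inf\Big\{\tfrac{\mathrm{rew}(\mathcal A,I)}{\mathrm{opt}(I)} : (\ell(I),h(I))\in\mathcal R\Big\}.$$ Here and below $0/0:=1$. **Geometry.** Let $\underline x,\bar x$ be the minimum and maximum of $x$ over $(x,y)\in\mathcal R$, and for $x\in[\underline x,\bar x]$ let $\bar h(x)=\sup\{y:(x,y)\in\mathcal R\}$ and $\underline h(x)=\inf\{y:(x,y)\in\mathcal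 R\}$. Let $x_H$ be the largest $x$ among the points of $\mathcal R$ that maximize $\min\{y,m\}$, and $x_L$ the smallest $x$ among the points of $\mathcal R$ that minimize $\min\{y,m\}$; put $y_L=\underline h(x_L)$. **Compatible ratios.** Put $$\mathrm{CP}_o(p;(x,y))=\frac{\min\{y,m\}r_h+\min\{x,(m-p)^+\}r_\ell}{\min\{y,m\}r_h+\min\{x,(m-y)^+\}r_\ell},$$ $$\mathrm{CP}_u(p;(x,y))=\frac{\max\{p,\min\{y,(m-x)^+\}\}r_h+\min\{x,m-p\}r_\ell}{\min\{y,m\}r_h+\min\{x,(m-y)^+\}r_\ell}.$$ **Bounds.** Let $C\in[0,1]$. * *Upper bound.* Let $\bar x_u=x_L$ if $x_L+y_L\ge m$; otherwise $\bar x_u$ is the supremum of the set consisting of $x_L$ and all $x\in[x_L,\bar x]$ at which $\underline{\mathcal H}=\min\{\underline h,m\}$ has a left derivative with $(1-C)\frac{r_h}{r_\ell}\underline{\mathcal H}'(x^-)-C<0$. For $x\in[\underline x,\bar x_u]$ let $u(x;C)=\sup\{p\in[0,m]:\mathrm{CP}_o(p;(x,\underline h(x)))=C\}$, read as $m$ if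 there is no such $p$; let $u(x;C)=u(\bar x_u;C)$ for $x\in[\bar x_u,\bar x]$ and $u(x;C)=m$ for $x<\underline x$. * *Lower bound.* For $x\in[x_H,\bar x]$ let $l(x;C)=\inf\{p\in[0,m]:\mathrm{CP}_u(p;(x,\bar h(x)))=C\}$, read as $0$ if there is no such $p$; let $l(x;C)=l(x_H;C)$ for $x\le x_H$. Let $x_{-1}$ be the infimum of the $x\in[x_H,\bar x]$ at which $l(\cdot;C)$ has a left derivative that is at most $-1$, and $x_{-1}=\bar x$ if there are none. Let $\widetilde l(x;C)=l(x;C)$ for $x\le x_{-1}$ and $\widetilde l(x;C)=\big(-(x-x_{-1})+l(x_{-1};C)\big)^+$ for $x_{-1}<x\le\bar x$. A *valid protection level function* is a continuous non-increasing function $p:[0,\bar x]\to[0,m]$ with slope at least $-1$, i.e. $p(x)-(x'-x)\le p(x')\le p(x)$ for $x\le x'$. **Theorem.** For every such $\mathcal R$, the maximum $$C^\star(\mathcal R)=\max\Big\{C\in[0,1] : \text{some valid } p \text{ satisfies } \widetilde l(x;C)\le p(x)\le u(x;C)\ \text{for all } x\in[\underline x,\bar x]\Big\}$$ is attained; every online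 algorithm $\mathcal A$, deterministic or randomized, has $\mathrm{consis}(\mathcal A)\le C^\star(\mathcal R)$; and $C^\star(\mathcal R)\ge\rho$, where $\rho=1/(2-r_\ell/r_h)$. -/

import Mathlib

open MeasureTheory Set

noncomputable section

/-! ## Requests, arrival sequences, online algorithms -/

/-- The two types of requests. -/
inductive Kind where
  | low
  | high

/-- A request: a positive size together with a type. -/
structure Request where
  size : ℝ
  kind : Kind
  size_pos : 0 < size

/-- Reward per unit of resource allocated to a request of the given type. -/
def Kind.reward (rl rh : ℝ) : Kind → ℝ
  | Kind.low => rl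
  | Kind.high => rh

/-- Contribution of a request to the total low-reward demand. -/
def Request.lowSize (r : Request) : ℝ :=
  match r.kind with
  | Kind.low => r.size
  | Kind.high => 0

/-- Contribution of a request to the total high-reward demand. -/
def Request.highSize (r : Request) : ℝ :=
  match r.kind with
  | Kind.low => 0
  | Kind.high => r.size

/-- Total low-reward demand of an arrival sequence (a finite list of requests of any length). -/
def lowDemand (I : List Request) : ℝ := (I.map Request.lowSize).sum

/-- Total high-reward demand of an arrival sequence. -/
def highDemand (I : List Request) : ℝ := (I.map Request.highSize).sum

/-- A deterministic online algorithm with `m` units of resource. `alloc past r` is the amount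
irrevocably allocated to the request `r` when the earlier requests were `past`; it sees neither the
future requests nor the number of rounds. (The algorithm's own earlier allocations are
determined by `past`.) -/
structure OnlineAlgorithm (m : ℝ) where
  alloc : List Request → Request → ℝ
  alloc_nonneg : ∀ past r, 0 ≤ alloc past r
  alloc_le_size : ∀ past r, alloc past r ≤ r.size
  capacity : ∀ I : List Request, ∑ t : Fin I.length, alloc (I.take t) (I.get t) ≤ m

/-- Cumulative reward of a deterministic online algorithm on the arrival sequence `I`. -/
def OnlineAlgorithm.reward {m : ℝ} (rl rh : ℝ) (A : OnlineAlgorithm m) (I : List Request) : ℝ :=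
  ∑ t : Fin I.length, A.alloc (I.take t) (I.get t) * (I.get t).kind.reward rl rh

/-- A randomized online algorithm: a random choice (with outcomes in `Ω`) of a deterministic online
algorithm. A deterministic algorithm is the special case of a constant family. -/
structure RandomizedAlgorithm (m : ℝ) (Ω : Type*) [MeasurableSpace Ω] where
  toAlg : Ω → OnlineAlgorithm m
  measurable_alloc : ∀ past r, Measurable fun ω => (toAlg ω).alloc past r

/-- Expected cumulative reward. -/
def RandomizedAlgorithm.rew {m : ℝ} (rl rh : ℝ) {Ω : Type*} [MeasurableSpace Ω] (μ : Measure Ω)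
    (A : RandomizedAlgorithm m Ω) (I : List Request) : ℝ :=
  ∫ ω, (A.toAlg ω).reward rl rh I ∂μ

/-- Optimal clairvoyant reward: the best total reward of a feasible allocation that is chosen with
full knowledge of the arrival sequence. -/
def opt (m rl rh : ℝ) (I : List Request) : ℝ :=
  sSup {v | ∃ a : Fin I.length → ℝ, (∀ t, 0 ≤ a t ∧ a t ≤ (I.get t).size) ∧ ∑ t, a t ≤ m ∧
    v = ∑ t, a t * (I.get t).kind.reward rl rh}

/-- The quotient `a / b`, with the convention `0 / 0 = 1`. Zero denominators occur only when there
is no demand at all, and then both rewards are zero. -/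
def perfRatio (a b : ℝ) : ℝ := if b = 0 then 1 else a / b

/-- The arrival sequences that are consistent with the ML region `R`. -/
def consistentSet (R : Set (ℝ × ℝ)) : Set (List Request) :=
  {I | (lowDemand I, highDemand I) ∈ R}

/-- The consistent ratio of a (randomized) online algorithm under the ML region `R`. -/
def consis {m : ℝ} (rl rh : ℝ) (R : Set (ℝ × ℝ)) {Ω : Type*} [MeasurableSpace Ω] (μ : Measure Ω)
    (A : RandomizedAlgorithm m Ω) : ℝ :=
  sInf ((fun I => perfRatio (A.rew rl rh μ I) (opt m rl rh I)) '' consistentSet R)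

/-! ## Geometry of the ML region -/

section Region

variable (m : ℝ) (R : Set (ℝ × ℝ))

/-- Smallest low-reward demand in the region. -/
def xMin : ℝ := sInf (Prod.fst '' R)

/-- Largest low-reward demand in the region. -/
def xMax : ℝ := sSup (Prod.fst '' R)

/-- Upper envelope of the region. -/
def hUp (x : ℝ) : ℝ := sSup {y | (x, y) ∈ R}

/-- Lower envelope of the region. -/
def hLow (x : ℝ) : ℝ := sInf {y | (x, y) ∈ R}

/-- The points of the region that maximize the capped high-reward demand `min y m`. -/
def topSet : Set (ℝ × ℝ) := {z ∈ R | ∀ w ∈ R, min w.2 m ≤ min z.2 m}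

/-- The points of the region that minimize the capped high-reward demand `min y m`. -/
def bottomSet : Set (ℝ × ℝ) := {z ∈ R | ∀ w ∈ R, min z.2 m ≤ min w.2 m}

/-- First coordinate of `H`, the point of the top set with the highest low-reward demand. -/
def xH : ℝ := sSup (Prod.fst '' topSet m R)

/-- First coordinate of `L`, the point of the bottom set with the lowest low-reward demand. -/
def xL : ℝ := sInf (Prod.fst '' bottomSet m R)

end Region

/-! ## Compatible ratios and the bounds on the protection level -/

section Bounds

variable (m rl rh : ℝ)

/-- Compatible ratio of the point `(x, y)` under protection level `p`, over-protected case. -/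
def CPo (p x y : ℝ) : ℝ :=
  perfRatio (min y m * rh + min x (max (m - p) 0) * rl)
    (min y m * rh + min x (max (m - y) 0) * rl)

/-- Compatible ratio of the point `(x, y)` under protection level `p`, under-protected case. -/
def CPu (p x y : ℝ) : ℝ :=
  perfRatio (max p (min y (max (m - x) 0)) * rh + min x (m - p) * rl)
    (min y m * rh + min x (max (m - y) 0) * rl)

variable (R : Set (ℝ × ℝ)) (C : ℝ)

/-- Right end of the range on which `u` is given by its defining equation. The quotient of
differences from the left tends to the left derivative `d` of `min (hLow ·) m` at `x`. -/
def xBarU : ℝ :=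
  open Classical in
  if m ≤ xL m R + hLow R (xL m R) then xL m R
  else sSup (insert (xL m R) {x ∈ Icc (xL m R) (xMax R) |
    ∃ d : ℝ, HasDerivWithinAt (fun t => min (hLow R t) m) d (Iio x) x ∧
      (1 - C) * (rh / rl) * d - C < 0})

/-- The largest protection level with compatible ratio exactly `C` at the lower envelope point of
abscissa `x`; it is `m` if there is none (then even the level `m` has compatible ratio above
`C`, for `C ≤ 1`). -/
def uEq (x : ℝ) : ℝ :=
  open Classical in
  if {p ∈ Icc 0 m | CPo m rl rh p x (hLow R x) = C}.Nonempty then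
    sSup {p ∈ Icc 0 m | CPo m rl rh p x (hLow R x) = C}
  else m

/-- The upper bound function `u(x; C)`. -/
def uBound (x : ℝ) : ℝ :=
  open Classical in
  if x < xMin R then m
  else if x ≤ xBarU m rl rh R C then uEq m rl rh R C x
  else uEq m rl rh R C (xBarU m rl rh R C)

/-- The smallest protection level with compatible ratio exactly `C` at the upper envelope point of
abscissa `x`; it is `0` if there is none (then even the level `0` has compatible ratio above
`C`, for `C ≤ 1`). -/
def lEq (x : ℝ) : ℝ :=
  open Classical in
  if {p ∈ Icc 0 m | CPu m rl rh p x (hUp R x) = C}.Nonempty then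
    sInf {p ∈ Icc 0 m | CPu m rl rh p x (hUp R x) = C}
  else 0

/-- The lower bound function `l(x; C)`. -/
def lBound (x : ℝ) : ℝ :=
  open Classical in
  if x ≤ xH m R then lEq m rl rh R C (xH m R) else lEq m rl rh R C x

/-- The points right of `x_H` at which the left derivative of `l(·; C)` is at most `-1`. -/
def steepSet : Set ℝ :=
  {x ∈ Icc (xH m R) (xMax R) |
    ∃ d : ℝ, HasDerivWithinAt (lBound m rl rh R C) d (Iio x) x ∧ d ≤ -1}

/-- The point `x_{-1}` from which on `l(·; C)` falls at slope `-1` or steeper; the right end of the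
region if there is no such point. -/
def xNegOne : ℝ :=
  open Classical in
  if (steepSet m rl rh R C).Nonempty then sInf (steepSet m rl rh R C) else xMax R

/-- The modified lower bound function `l̃(x; C)`. -/
def lTilde (x : ℝ) : ℝ :=
  open Classical in
  if x ≤ xNegOne m rl rh R C then lBound m rl rh R C x
  else max (-(x - xNegOne m rl rh R C) + lBound m rl rh R C (xNegOne m rl rh R C)) 0

end Bounds

/-! ## The optimization problem -/

/-- Valid protection level functions on `[0, X]`: values in `[0, m]`, continuous and non-increasing
with slope at least `-1` (that is, non-increasing and Lipschitz with constant `1`). -/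
def ValidPL (m X : ℝ) (p : ℝ → ℝ) : Prop :=
  MapsTo p (Icc 0 X) (Icc 0 m) ∧ AntitoneOn p (Icc 0 X) ∧ LipschitzOnWith 1 p (Icc 0 X)

/-- The ratios `C` that are feasible for the optimization problem. -/
def feasibleRatios (m rl rh : ℝ) (R : Set (ℝ × ℝ)) : Set ℝ :=
  {C | C ∈ Icc (0 : ℝ) 1 ∧ ∃ p : ℝ → ℝ, ValidPL m (xMax R) p ∧
    ∀ x ∈ Icc (xMin R) (xMax R), lTilde m rl rh R C x ≤ p x ∧ p x ≤ uBound m rl rh R C x}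

/-- The value `C⋆(R)` of the optimization problem. -/
def Cstar (m rl rh : ℝ) (R : Set (ℝ × ℝ)) : ℝ := sSup (feasibleRatios m rl rh R)

end

/-! ## Envelopes of a planar compact convex region -/

section Envelopes

variable {R : Set (ℝ × ℝ)}

/-! The bounds have closed forms. Ratio `C` at a lower envelope point forces an amount `forcedLow`
of low-reward allocation, so u = m - max(`forcedLow`, 0) there. At an upper envelope point l equals
`criticalLevel` if that exceeds (m - x)^+, and 0 otherwise. The derivative conditions defining
`xBarU` and `xNegOne` only mark where these pointwise constraints stop binding: beyond these points,
convexity of the region together with monotonicity of p (for u) or its slope bound (for l) gives the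
rest. Hence feasibility of `C` is the pointwise condition `LevelCompatible`
(`mem_feasibleRatios_iff`).

That condition is closed jointly in `C` and p, and valid functions form a compact set for pointwise
convergence. The feasible ratios are therefore compact; they contain ρ because the constant level
m(1 - ρ) works. This gives attainment and the bound by ρ.

For the upper bound, feed an algorithm low requests of total x and let p(x) be m minus its expected
allocation. Along nested sequences p is non-increasing with slope at least -1. Stopping there, or
adding one high request of size y, realizes any point (x, y) of the region, and the guaranteed
reward yields both constraints on p(x) (`consis_mul_le`). Only expectations enter, so randomization
does not help. A finite sequence visits only finitely many totals; compactness passes from finite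
sets of x to all x (`exists_levelCompatible`). So the consistency of the algorithm is itself a
feasible ratio. -/

lemma isCompact_fst_image (hcomp : IsCompact R) : IsCompact (Prod.fst '' R) :=
  hcomp.image continuous_fst

lemma xMin_le_fst (hcomp : IsCompact R) {z : ℝ × ℝ} (hz : z ∈ R) : xMin R ≤ z.1 :=
  csInf_le (isCompact_fst_image hcomp).bddBelow (mem_image_of_mem _ hz)

lemma fst_le_xMax (hcomp : IsCompact R) {z : ℝ × ℝ} (hz : z ∈ R) : z.1 ≤ xMax R :=
  le_csSup (isCompact_fst_image hcomp).bddAbove (mem_image_of_mem _ hz)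

lemma fst_mem_Icc (hcomp : IsCompact R) {z : ℝ × ℝ} (hz : z ∈ R) :
    z.1 ∈ Icc (xMin R) (xMax R) :=
  ⟨xMin_le_fst hcomp hz, fst_le_xMax hcomp hz⟩

lemma exists_mem_of_mem_Icc (hne : R.Nonempty) (hconv : Convex ℝ R) (hcomp : IsCompact R)
    {x : ℝ} (hx : x ∈ Icc (xMin R) (xMax R)) : ∃ y, (x, y) ∈ R := by
  have hc := isCompact_fst_image hcomp
  have hcv : Convex ℝ (Prod.fst '' R) := hconv.linear_image (LinearMap.fst ℝ ℝ ℝ)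
  obtain ⟨z, hz, rfl⟩ := hcv.ordConnected.out (hc.sInf_mem (hne.image _))
    (hc.sSup_mem (hne.image _)) hx
  exact ⟨z.2, hz⟩

lemma isCompact_fiber (hcomp : IsCompact R) (x : ℝ) : IsCompact {y | (x, y) ∈ R} := by
  have : {y | (x, y) ∈ R} = Prod.snd '' (R ∩ Prod.fst ⁻¹' {x}) := by
    ext y
    simp
  rw [this]
  exact (hcomp.inter_right (isClosed_singleton.preimage continuous_fst)).image continuous_snd

lemma hUp_mem (hne : R.Nonempty) (hconv : Convex ℝ R) (hcomp : IsCompact R)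
    {x : ℝ} (hx : x ∈ Icc (xMin R) (xMax R)) : (x, hUp R x) ∈ R :=
  (isCompact_fiber hcomp x).sSup_mem (exists_mem_of_mem_Icc hne hconv hcomp hx)

lemma hLow_mem (hne : R.Nonempty) (hconv : Convex ℝ R) (hcomp : IsCompact R)
    {x : ℝ} (hx : x ∈ Icc (xMin R) (xMax R)) : (x, hLow R x) ∈ R :=
  (isCompact_fiber hcomp x).sInf_mem (exists_mem_of_mem_Icc hne hconv hcomp hx)

lemma le_hUp (hcomp : IsCompact R) {x y : ℝ} (h : (x, y) ∈ R) : y ≤ hUp R x :=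
  le_csSup (isCompact_fiber hcomp x).bddAbove h

lemma hLow_le (hcomp : IsCompact R) {x y : ℝ} (h : (x, y) ∈ R) : hLow R x ≤ y :=
  csInf_le (isCompact_fiber hcomp x).bddBelow h

lemma convexOn_hLow (hne : R.Nonempty) (hconv : Convex ℝ R) (hcomp : IsCompact R) :
    ConvexOn ℝ (Icc (xMin R) (xMax R)) (hLow R) := by
  refine ⟨convex_Icc _ _, fun x hx y hy a b ha hb hab => ?_⟩
  exact hLow_le hcomp (hconv (hLow_mem hne hconv hcomp hx) (hLow_mem hne hconv hcomp hy) ha hb hab)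

lemma concaveOn_hUp (hne : R.Nonempty) (hconv : Convex ℝ R) (hcomp : IsCompact R) :
    ConcaveOn ℝ (Icc (xMin R) (xMax R)) (hUp R) := by
  refine ⟨convex_Icc _ _, fun x hx y hy a b ha hb hab => ?_⟩
  exact le_hUp hcomp (hconv (hUp_mem hne hconv hcomp hx) (hUp_mem hne hconv hcomp hy) ha hb hab)

lemma concaveOn_min_hUp (hne : R.Nonempty) (hconv : Convex ℝ R) (hcomp : IsCompact R) (m : ℝ) :
    ConcaveOn ℝ (Icc (xMin R) (xMax R)) fun x => min (hUp R x) m :=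
  (concaveOn_hUp hne hconv hcomp).inf (concaveOn_const m (convex_Icc _ _))

lemma exists_mem_topSet (hcomp : IsCompact R) (hne : R.Nonempty) (m : ℝ) :
    ∃ z ∈ topSet m R, z.1 = xH m R := by
  have hcont : Continuous fun z : ℝ × ℝ => min z.2 m := by fun_prop
  have hc : IsCompact (topSet m R) := by
    have : topSet m R = R ∩ ⋂ w ∈ R, {z : ℝ × ℝ | min w.2 m ≤ min z.2 m} := by
      ext z
      simp [topSet]
    rw [this]
    exact hcomp.inter_right (isClosed_biInter fun w _ => isClosed_le continuous_const hcont)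
  obtain ⟨z, hz, hmax⟩ := hcomp.exists_isMaxOn hne hcont.continuousOn
  have hn : (topSet m R).Nonempty := ⟨z, hz, fun w hw => hmax hw⟩
  obtain ⟨w, hw, h⟩ := (hc.image continuous_fst).sSup_mem (hn.image Prod.fst)
  exact ⟨w, hw, h⟩

lemma exists_mem_bottomSet (hcomp : IsCompact R) (hne : R.Nonempty) (m : ℝ) :
    ∃ z ∈ bottomSet m R, z.1 = xL m R := by
  have hcont : Continuous fun z : ℝ × ℝ => min z.2 m := by fun_prop
  have hc : IsCompact (bottomSet m R) := by
    have : bottomSet m R = R ∩ ⋂ w ∈ R, {z : ℝ × ℝ | min z.2 m ≤ min w.2 m} := by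
      ext z
      simp [bottomSet]
    rw [this]
    exact hcomp.inter_right (isClosed_biInter fun w _ => isClosed_le hcont continuous_const)
  obtain ⟨z, hz, hmin⟩ := hcomp.exists_isMinOn hne hcont.continuousOn
  have hn : (bottomSet m R).Nonempty := ⟨z, hz, fun w hw => hmin hw⟩
  obtain ⟨w, hw, h⟩ := (hc.image continuous_fst).sInf_mem (hn.image Prod.fst)
  exact ⟨w, hw, h⟩

lemma xH_mem_Icc (hcomp : IsCompact R) (hne : R.Nonempty) (m : ℝ) :
    xH m R ∈ Icc (xMin R) (xMax R) := by
  obtain ⟨z, hz, h⟩ := exists_mem_topSet hcomp hne m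
  exact h ▸ fst_mem_Icc hcomp hz.1

lemma xL_mem_Icc (hcomp : IsCompact R) (hne : R.Nonempty) (m : ℝ) :
    xL m R ∈ Icc (xMin R) (xMax R) := by
  obtain ⟨z, hz, h⟩ := exists_mem_bottomSet hcomp hne m
  exact h ▸ fst_mem_Icc hcomp hz.1

lemma min_le_min_hUp_xH (hcomp : IsCompact R) (hne : R.Nonempty) (m : ℝ) {w : ℝ × ℝ}
    (hw : w ∈ R) : min w.2 m ≤ min (hUp R (xH m R)) m := by
  obtain ⟨z, hz, h⟩ := exists_mem_topSet hcomp hne m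
  exact (hz.2 w hw).trans (min_le_min_right _ (h ▸ le_hUp hcomp hz.1))

lemma min_hLow_xL_le_min (hcomp : IsCompact R) (hne : R.Nonempty) (m : ℝ) {w : ℝ × ℝ}
    (hw : w ∈ R) : min (hLow R (xL m R)) m ≤ min w.2 m := by
  obtain ⟨z, hz, h⟩ := exists_mem_bottomSet hcomp hne m
  exact (min_le_min_right _ (h ▸ hLow_le hcomp hz.1)).trans (hz.2 w hw)

/-- Right of `x_H` the capped upper envelope is non-increasing. -/
lemma min_hUp_antitone (hne : R.Nonempty) (hconv : Convex ℝ R) (hcomp : IsCompact R) {m s x : ℝ}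
    (hs : xH m R ≤ s) (hsx : s ≤ x) (hx : x ≤ xMax R) : min (hUp R x) m ≤ min (hUp R s) m := by
  have hH := xH_mem_Icc hcomp hne m
  have hx' : x ∈ Icc (xMin R) (xMax R) := ⟨hH.1.trans (hs.trans hsx), hx⟩
  have h := (concaveOn_min_hUp hne hconv hcomp m).ge_on_segment hH hx' (z := s)
    (by rw [segment_eq_Icc (hs.trans hsx)]; exact ⟨hs, hsx⟩)
  have h2 := min_le_min_hUp_xH hcomp hne m (hUp_mem hne hconv hcomp hx')
  exact (le_min h2 le_rfl).trans h

/-- Right of `x_L` the lower envelope is non-decreasing, if it starts below the cap. -/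
lemma hLow_monotone (hne : R.Nonempty) (hconv : Convex ℝ R) (hcomp : IsCompact R) {m s x : ℝ}
    (hL : hLow R (xL m R) < m) (hs : xL m R ≤ s) (hsx : s ≤ x) (hx : x ≤ xMax R) :
    hLow R s ≤ hLow R x := by
  have hH := xL_mem_Icc hcomp hne m
  have hx' : x ∈ Icc (xMin R) (xMax R) := ⟨hH.1.trans (hs.trans hsx), hx⟩
  have h := (convexOn_hLow hne hconv hcomp).le_on_segment hH hx' (z := s)
    (by rw [segment_eq_Icc (hs.trans hsx)]; exact ⟨hs, hsx⟩)
  have h2 := min_hLow_xL_le_min hcomp hne m (hLow_mem hne hconv hcomp hx')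
  rw [min_eq_left hL.le] at h2
  exact h.trans (max_le (h2.trans (min_le_left _ _)) le_rfl)

end Envelopes

/-! ## Closed forms of the bounds -/

section ClosedForms

/-- The level above which a point with low demand beyond the remaining capacity and high demand `y`
has compatible ratio at least `C`. -/
noncomputable def criticalLevel (m rl rh C y : ℝ) : ℝ := C * min y m - (1 - C) * m * rl / (rh - rl)

/-- Amount of low-reward allocation that ratio `C` forces at the point `(x, y)`. -/
noncomputable def forcedLow (m rl rh C x y : ℝ) : ℝ :=
  C * min x (m - min y m) - (1 - C) * (rh / rl) * min y m

lemma max_sub_eq_sub_min (m y : ℝ) : max (m - y) 0 = m - min y m := by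
  rcases le_total y m with h | h
  · rw [min_eq_left h, max_eq_left (by linarith)]
  · rw [min_eq_right h, max_eq_right (by linarith), sub_self]

variable {m rl rh C : ℝ} {R : Set (ℝ × ℝ)}

/-- The critical level is the p solving p·rh + (m - p)·rl = C·opt when the optimum uses all the
capacity. -/
lemma criticalLevel_mul (hrh : rl < rh) (y : ℝ) :
    (rh - rl) * criticalLevel m rl rh C y =
      C * (min y m * rh + (m - min y m) * rl) - m * rl := by
  have : rh - rl ≠ 0 := by linarith
  unfold criticalLevel
  field_simp
  ring

/-- The forced amount is what low requests must earn, in units of `rl`, once all high demand up to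
the capacity is served. -/
lemma forcedLow_mul (hrl : 0 < rl) (x y : ℝ) :
    forcedLow m rl rh C x y * rl =
      C * (min y m * rh + min x (m - min y m) * rl) - min y m * rh := by
  unfold forcedLow
  field_simp
  ring

lemma criticalLevel_le (hm : 0 < m) (hrl : 0 < rl) (hrh : rl < rh) (hC : C ∈ Icc (0 : ℝ) 1) {y : ℝ}
    (hy : 0 ≤ y) : criticalLevel m rl rh C y ≤ min y m := by
  have h1 : 0 ≤ (1 - C) * m * rl / (rh - rl) :=
    div_nonneg (mul_nonneg (mul_nonneg (by linarith [hC.2]) hm.le) hrl.le) (by linarith)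
  have h2 : C * min y m ≤ 1 * min y m := mul_le_mul_of_nonneg_right hC.2 (le_min hy hm.le)
  unfold criticalLevel
  linarith

lemma forcedLow_le (hm : 0 < m) (hrl : 0 < rl) (hrh : rl < rh) (hC : C ∈ Icc (0 : ℝ) 1) (x : ℝ)
    {y : ℝ} (hy : 0 ≤ y) : forcedLow m rl rh C x y ≤ C * min x m := by
  have hY : 0 ≤ min y m := le_min hy hm.le
  have h1 : 0 ≤ (1 - C) * (rh / rl) * min y m :=
    mul_nonneg (mul_nonneg (by linarith [hC.2]) (div_nonneg (by linarith) hrl.le)) hY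
  have h2 : C * min x (m - min y m) ≤ C * min x m :=
    mul_le_mul_of_nonneg_left (min_le_min_left _ (by linarith)) hC.1
  unfold forcedLow
  linarith

lemma perfRatio_eq_iff {a b : ℝ} (hb : 0 < b) : perfRatio a b = C ↔ a = C * b := by
  rw [perfRatio, if_neg hb.ne', div_eq_iff hb.ne']

/-- High sales do not depend on p in `CPo`, so ratio `C` fixes the low sales as `forcedLow`. The
largest level permitting them leaves exactly that amount unprotected. -/
lemma uEq_eq (hm : 0 < m) (hrl : 0 < rl) (hrh : rl < rh) (hC : C ∈ Icc (0 : ℝ) 1) {x : ℝ}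
    (hx : 0 ≤ x) (hy : 0 ≤ hLow R x) :
    uEq m rl rh R C x = m - max (forcedLow m rl rh C x (hLow R x)) 0 := by
  classical
  obtain ⟨hC0, hC1⟩ := hC
  have hle := forcedLow_le hm hrl hrh ⟨hC0, hC1⟩ x hy
  have hmul := forcedLow_mul (m := m) (C := C) (rh := rh) hrl x (hLow R x)
  unfold uEq CPo
  simp only [max_sub_eq_sub_min m (hLow R x)]
  set g := forcedLow m rl rh C x (hLow R x)
  set y := hLow R x
  have hY : 0 ≤ min y m := le_min hy hm.le
  have hZ : 0 ≤ min x (m - min y m) := le_min hx (by linarith [min_le_right y m])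
  have hV : 0 ≤ min x m := le_min hx hm.le
  have hCV : C * min x m ≤ min x m := mul_le_of_le_one_left hV hC1
  have hYr : 0 ≤ min y m * rh := mul_nonneg hY (by linarith)
  have hZr : 0 ≤ min x (m - min y m) * rl := mul_nonneg hZ hrl.le
  rcases eq_or_lt_of_le (add_nonneg hYr hZr) with hD | hD
  -- With no demand every level has ratio 1, so the solution set is all of [0, m] or empty; either
  -- way the value is m.
  · simp only [← hD, perfRatio, if_true]
    have hg : max g 0 = 0 := by
      refine max_eq_right ?_
      rw [← hD] at hmul
      nlinarith
    rw [hg, sub_zero]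
    split_ifs with h
    · obtain ⟨p, hp, h1⟩ := h
      exact IsGreatest.csSup_eq ⟨⟨⟨hm.le, le_rfl⟩, h1⟩, fun q hq => hq.1.2⟩
    · rfl
  · simp only [perfRatio_eq_iff hD]
    rcases lt_or_ge 0 g with hg | hg
    · rw [max_eq_left hg.le]
      have hgm : g ≤ m := hle.trans (hCV.trans (min_le_right _ _))
      have hgx : g ≤ x := hle.trans (hCV.trans (min_le_left _ _))
      have hmem : m - g ∈ {p | p ∈ Icc 0 m ∧ min y m * rh + min x (max (m - p) 0) * rl =
          C * (min y m * rh + min x (m - min y m) * rl)} := by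
        refine ⟨⟨by linarith, by linarith⟩, ?_⟩
        rw [sub_sub_cancel, max_eq_left hg.le, min_eq_right hgx]
        linarith
      rw [if_pos ⟨_, hmem⟩]
      refine IsGreatest.csSup_eq ⟨hmem, ?_⟩
      rintro p ⟨⟨hp0, hpm⟩, hp⟩
      rw [max_eq_left (by linarith)] at hp
      have h1 : min x (m - p) * rl ≤ (m - p) * rl :=
        mul_le_mul_of_nonneg_right (min_le_right _ _) hrl.le
      nlinarith
    · rw [max_eq_right hg, sub_zero]
      split_ifs with h
      -- High sales alone already earn the fraction `C`, so a solution can only have zero low sales;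
      -- then m is a solution too.
      · obtain ⟨p, ⟨hp0, hpm⟩, hp⟩ := h
        rw [max_eq_left (by linarith)] at hp
        have h1 : 0 ≤ min x (m - p) * rl :=
          mul_nonneg (le_min hx (by linarith)) hrl.le
        have h2 : g * rl ≤ 0 := mul_nonpos_of_nonpos_of_nonneg hg hrl.le
        refine IsGreatest.csSup_eq ⟨⟨⟨hm.le, le_rfl⟩, ?_⟩, fun q hq => hq.1.2⟩
        rw [sub_self, max_self, min_eq_right hx]
        linarith
      · rfl

/-- If the critical level exceeds (m - x)^+, the optimum uses all the capacity, the equation at that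
level is linear with this root, and smaller levels earn strictly less. Otherwise level 0 already
reaches `C` and earns least among all levels, so if any level has ratio exactly `C`, so does 0. -/
lemma lEq_eq (hm : 0 < m) (hrl : 0 < rl) (hrh : rl < rh) (hC : C ∈ Icc (0 : ℝ) 1) {x : ℝ}
    (hx : 0 ≤ x) (hy : 0 ≤ hUp R x) :
    lEq m rl rh R C x =
      if max (m - x) 0 < criticalLevel m rl rh C (hUp R x)
      then criticalLevel m rl rh C (hUp R x) else 0 := by
  classical
  obtain ⟨hC0, hC1⟩ := hC
  have hle := criticalLevel_le hm hrl hrh ⟨hC0, hC1⟩ hy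
  have hmul := criticalLevel_mul (m := m) (C := C) hrh (hUp R x)
  unfold lEq CPu
  simp only [max_sub_eq_sub_min m (hUp R x)]
  set f := criticalLevel m rl rh C (hUp R x)
  set y := hUp R x
  have hY : 0 ≤ min y m := le_min hy hm.le
  have hYm : min y m ≤ m := min_le_right _ _
  have hYy : min y m ≤ y := min_le_left _ _
  have hZ : 0 ≤ min x (m - min y m) := le_min hx (by linarith)
  have hYr : 0 ≤ min y m * rh := mul_nonneg hY (by linarith)
  have hZr : 0 ≤ min x (m - min y m) * rl := mul_nonneg hZ hrl.le
  rcases eq_or_lt_of_le (add_nonneg hYr hZr) with hD | hD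
  · simp only [← hD, perfRatio, if_true]
    have hY0 : min y m = 0 := by
      have : min y m * rh = 0 := by linarith
      rcases mul_eq_zero.1 this with h | h <;> linarith
    rw [hY0] at hle
    rw [if_neg (c := max (m - x) 0 < f) (not_lt.2 (hle.trans (le_max_right _ _)))]
    split_ifs with h
    · obtain ⟨p, hp, h1⟩ := h
      exact IsLeast.csInf_eq ⟨⟨⟨le_rfl, hm.le⟩, h1⟩, fun q hq => hq.1.1⟩
    · rfl
  · simp only [perfRatio_eq_iff hD]
    split_ifs with h h' h'
    · obtain ⟨hf1, hf2⟩ := max_lt_iff.1 h'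
      have hc : min y (max (m - x) 0) = max (m - x) 0 := min_eq_right (by linarith [h'.le])
      have hD' : min x (m - min y m) = m - min y m := min_eq_right (by linarith)
      rw [hc, hD']
      refine IsLeast.csInf_eq ⟨⟨⟨hf2.le, by linarith⟩, ?_⟩, ?_⟩
      · rw [max_eq_left h'.le, min_eq_right (by linarith)]
        linarith
      · rintro p ⟨⟨hp0, hpm⟩, hp⟩
        by_contra! hpf
        have h3 : max p (max (m - x) 0) < f := max_lt hpf h'
        rcases le_total p (m - x) with h4 | h4
        · rw [max_eq_left (a := m - x) (by linarith), max_eq_right h4,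
            min_eq_left (by linarith)] at hp
          nlinarith
        · rw [max_eq_left (a := p) (max_le h4 hp0), min_eq_right (by linarith)] at hp
          nlinarith
    · obtain ⟨p, ⟨hp0, hpm⟩, hp⟩ := h
      have hf : f ≤ max (m - x) 0 := not_lt.1 h'
      set D := min y m * rh + min x (m - min y m) * rl
      set c := min y (max (m - x) 0)
      have hc0 : 0 ≤ c := le_min hy (le_max_right _ _)
      -- The right side is the reward at level 0; `hmono` below shows that no level earns less.
      have hCD : C * D ≤ c * rh + min x m * rl := by
        rcases le_total (x + min y m) m with h1 | h1
        · have h2 : min y m ≤ c := le_min hYy (le_max_of_le_left (by linarith))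
          have h3 : min x (m - min y m) ≤ min x m := min_le_min_left _ (by linarith)
          have h4 : min y m * rh ≤ c * rh := mul_le_mul_of_nonneg_right h2 (by linarith)
          have h5 := mul_le_mul_of_nonneg_right h3 hrl.le
          have h6 : C * D ≤ D := mul_le_of_le_one_left hD.le hC1
          have h7 : D ≤ c * rh + min x m * rl := add_le_add h4 h5
          exact h6.trans h7
        · have hD' : D = min y m * rh + (m - min y m) * rl := by
            simp only [D]
            rw [min_eq_right (a := x) (b := m - min y m) (by linarith)]
          rw [← hD'] at hmul
          have h2 : (rh - rl) * f ≤ (rh - rl) * max (m - x) 0 :=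
            mul_le_mul_of_nonneg_left hf (by linarith)
          rcases le_total x m with h3 | h3
          · have : c = m - x := by
              simp only [c]
              rw [max_eq_left (by linarith), min_eq_right (by linarith)]
            rw [this, min_eq_left h3]
            rw [max_eq_left (by linarith)] at h2
            linarith
          · rw [min_eq_right h3]
            rw [max_eq_right (by linarith)] at h2
            have := mul_nonneg hc0 (by linarith : 0 ≤ rh)
            linarith
      have hmono : c * rh + min x m * rl ≤ max p c * rh + min x (m - p) * rl := by
        rcases le_total p (m - x) with h1 | h1
        · rw [min_eq_left (by linarith), min_eq_left (by linarith)]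
          have := mul_le_mul_of_nonneg_right (le_max_right p c) (by linarith : 0 ≤ rh)
          linarith
        · have hcx : c ≤ max (m - x) 0 := min_le_right _ _
          have h2 : c ≤ p := hcx.trans (max_le h1 hp0)
          rw [max_eq_left h2, min_eq_right (a := x) (b := m - p) (by linarith)]
          rcases le_total x m with h3 | h3
          · rw [max_eq_left (by linarith)] at hcx
            rw [min_eq_left h3]
            nlinarith
          · rw [max_eq_right (by linarith)] at hcx
            rw [min_eq_right h3]
            nlinarith
      refine IsLeast.csInf_eq ⟨⟨⟨le_rfl, hm.le⟩, ?_⟩, fun q hq => hq.1.1⟩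
      rw [max_eq_right hc0, sub_zero]
      exact le_antisymm (by linarith) (by linarith)
    · exfalso
      obtain ⟨hf1, hf2⟩ := max_lt_iff.1 h'
      have hc : min y (max (m - x) 0) = max (m - x) 0 := min_eq_right (by linarith [h'.le])
      have hD' : min x (m - min y m) = m - min y m := min_eq_right (by linarith)
      refine h ⟨f, ⟨hf2.le, by linarith⟩, ?_⟩
      rw [hc, hD', max_eq_left h'.le, min_eq_right (by linarith)]
      linarith
    · rfl

end ClosedForms

/-! ## Eliminating the derivative conditions from the bounds -/

section PointwiseBounds

variable {m rl rh C : ℝ} {R : Set (ℝ × ℝ)}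

lemma xBarU_bddAbove (hcomp : IsCompact R) (hne : R.Nonempty) (P : ℝ → Prop) :
    BddAbove (insert (xL m R) {x ∈ Icc (xL m R) (xMax R) | P x}) := by
  refine ⟨xMax R, ?_⟩
  rintro x (rfl | hx)
  · exact (xL_mem_Icc hcomp hne m).2
  · exact hx.1.2

lemma xL_le_xBarU (hcomp : IsCompact R) (hne : R.Nonempty) : xL m R ≤ xBarU m rl rh R C := by
  unfold xBarU
  split_ifs
  · exact le_rfl
  · exact le_csSup (xBarU_bddAbove hcomp hne _) (mem_insert _ _)

lemma xBarU_le_xMax (hcomp : IsCompact R) (hne : R.Nonempty) :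
    xBarU m rl rh R C ≤ xMax R := by
  unfold xBarU
  split_ifs
  · exact (xL_mem_Icc hcomp hne m).2
  · refine csSup_le (insert_nonempty _ _) ?_
    rintro x (rfl | hx)
    · exact (xL_mem_Icc hcomp hne m).2
    · exact hx.1.2

/-- Right of `xBarU` the lower envelope grows fast enough to make `forcedLow` non-increasing. -/
lemma mul_sub_le_of_xBarU_lt (hne : R.Nonempty) (hconv : Convex ℝ R) (hcomp : IsCompact R)
    (hquad : ∀ z ∈ R, 0 ≤ z.1 ∧ 0 ≤ z.2) (hrl : 0 < rl) (hrh : rl < rh) (hC1 : C ≤ 1)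
    (hL : xL m R + hLow R (xL m R) < m) {z w : ℝ} (hz : xBarU m rl rh R C < z) (hzw : z < w)
    (hw : w ≤ xMax R) (hzm : hLow R z < m) :
    C * (w - z) ≤ (1 - C) * (rh / rl) * (hLow R w - hLow R z) := by
  have hLI := xL_mem_Icc hcomp hne m
  have hL0 : 0 ≤ xL m R := (hquad _ (hLow_mem hne hconv hcomp hLI)).1
  have hLm : hLow R (xL m R) < m := by linarith
  have hLz : xL m R < z := (xL_le_xBarU hcomp hne).trans_lt hz
  have hint : z ∈ interior (Icc (xMin R) (xMax R)) := by
    rw [interior_Icc]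
    exact ⟨hLI.1.trans_lt hLz, hzw.trans_le hw⟩
  have hcv := convexOn_hLow hne hconv hcomp
  have hd := hcv.hasDerivWithinAt_leftDeriv_of_mem_interior hint
  set d := derivWithin (hLow R) (Iio z) z
  have hd' : HasDerivWithinAt (fun t => min (hLow R t) m) d (Iio z) z := by
    refine hd.congr_of_eventuallyEq ?_ (min_eq_left hzm.le)
    filter_upwards [Ioo_mem_nhdsLT hLz] with t ht
    exact min_eq_left ((hLow_monotone hne hconv hcomp hLm ht.1.le ht.2.le
      (hzw.le.trans hw)).trans hzm.le)
  -- Otherwise z would belong to the set whose supremum is `xBarU`.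
  have hdC : 0 ≤ (1 - C) * (rh / rl) * d - C := by
    by_contra! hneg
    refine hz.not_ge ?_
    unfold xBarU
    rw [if_neg (not_le.2 hL)]
    exact le_csSup (xBarU_bddAbove hcomp hne _)
      (mem_insert_of_mem _ ⟨⟨hLz.le, hzw.le.trans hw⟩, d, hd', hneg⟩)
  have hslope : d ≤ slope (hLow R) z w :=
    (hcv.leftDeriv_le_rightDeriv_of_mem_interior hint).trans
      (hcv.rightDeriv_le_slope_of_mem_interior hint ⟨hLI.1.trans (hLz.le.trans hzw.le), hw⟩ hzw)
  rw [slope_def_field, le_div_iff₀ (by linarith)] at hslope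
  have h1 : 0 ≤ (1 - C) * (rh / rl) :=
    mul_nonneg (by linarith) (div_nonneg (by linarith) hrl.le)
  calc C * (w - z) ≤ (1 - C) * (rh / rl) * d * (w - z) :=
        mul_le_mul_of_nonneg_right (by linarith) (by linarith)
    _ = (1 - C) * (rh / rl) * (d * (w - z)) := by ring
    _ ≤ _ := mul_le_mul_of_nonneg_left hslope h1

/-- Limit of the preceding estimate as z decreases to `xBarU`. Projecting a compact part of the
region replaces continuity of the envelope: the limit point lies on or above it. -/
lemma mul_sub_xBarU_le (hne : R.Nonempty) (hconv : Convex ℝ R) (hcomp : IsCompact R)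
    (hquad : ∀ z ∈ R, 0 ≤ z.1 ∧ 0 ≤ z.2) (hrl : 0 < rl) (hrh : rl < rh) (hC1 : C ≤ 1)
    (hL : xL m R + hLow R (xL m R) < m) {w : ℝ} (hbw : xBarU m rl rh R C < w)
    (hw : w ≤ xMax R) (hwm : hLow R w < m) :
    C * (w - xBarU m rl rh R C) ≤
      (1 - C) * (rh / rl) * (hLow R w - hLow R (xBarU m rl rh R C)) := by
  have hLI := xL_mem_Icc hcomp hne m
  have hL0 : 0 ≤ xL m R := (hquad _ (hLow_mem hne hconv hcomp hLI)).1
  have hLb : xL m R ≤ xBarU m rl rh R C := xL_le_xBarU hcomp hne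
  set b := xBarU m rl rh R C
  set K := (1 - C) * (rh / rl)
  have hK : 0 ≤ K := mul_nonneg (by linarith) (div_nonneg (by linarith) hrl.le)
  let T : Set (ℝ × ℝ) := R ∩ {z | C * (w - z.1) ≤ K * (hLow R w - z.2)}
  have hT : IsClosed (Prod.fst '' T) :=
    ((hcomp.inter_right (isClosed_le (by fun_prop) (by fun_prop))).image
      continuous_fst).isClosed
  have hsub : Ioo b w ⊆ Prod.fst '' T := by
    intro z hz
    have hzx : z ≤ xMax R := hz.2.le.trans hw
    refine ⟨(z, hLow R z), ⟨hLow_mem hne hconv hcomp ⟨hLI.1.trans (hLb.trans hz.1.le), hzx⟩, ?_⟩,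
      rfl⟩
    refine mul_sub_le_of_xBarU_lt hne hconv hcomp hquad hrl hrh hC1 hL hz.1 hz.2 hw ?_
    exact (hLow_monotone hne hconv hcomp (by linarith) (hLb.trans hz.1.le) hz.2.le hw).trans_lt hwm
  have hb : b ∈ closure (Ioo b w) := by
    rw [closure_Ioo hbw.ne]
    exact left_mem_Icc.2 hbw.le
  obtain ⟨⟨b', y⟩, ⟨hyR, hy⟩, rfl⟩ := hT.closure_subset_iff.2 hsub hb
  exact hy.trans (mul_le_mul_of_nonneg_left (by linarith [hLow_le hcomp hyR]) hK)

/-- Once capacity binds, more high demand only lowers the forced amount. Before that, the slope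
estimate says that growing high demand outweighs growing low demand. -/
lemma forcedLow_le_forcedLow_xBarU (hne : R.Nonempty) (hconv : Convex ℝ R) (hcomp : IsCompact R)
    (hquad : ∀ z ∈ R, 0 ≤ z.1 ∧ 0 ≤ z.2) (hrl : 0 < rl) (hrh : rl < rh)
    (hC : C ∈ Icc (0 : ℝ) 1) {x : ℝ} (hbx : xBarU m rl rh R C < x) (hx : x ≤ xMax R) :
    forcedLow m rl rh C x (hLow R x) ≤
      forcedLow m rl rh C (xBarU m rl rh R C) (hLow R (xBarU m rl rh R C)) := by
  obtain ⟨hC0, hC1⟩ := hC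
  have hLI := xL_mem_Icc hcomp hne m
  have hL0 : 0 ≤ xL m R := (hquad _ (hLow_mem hne hconv hcomp hLI)).1
  have hLb : xL m R ≤ xBarU m rl rh R C := xL_le_xBarU hcomp hne
  have hK : 0 ≤ (1 - C) * (rh / rl) := mul_nonneg (by linarith) (div_nonneg (by linarith) hrl.le)
  have hxR := hLow_mem hne hconv hcomp (x := x) ⟨hLI.1.trans (hLb.trans hbx.le), hx⟩
  have hcapped : ∀ b, m ≤ b + min (hLow R b) m → min (hLow R b) m ≤ min (hLow R x) m →
      forcedLow m rl rh C x (hLow R x) ≤ forcedLow m rl rh C b (hLow R b) := by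
    intro b hb hY
    unfold forcedLow
    rw [min_eq_right (a := b) (b := m - min (hLow R b) m) (by linarith)]
    have h1 : min x (m - min (hLow R x) m) ≤ m - min (hLow R b) m :=
      (min_le_right _ _).trans (by linarith)
    have h2 := mul_le_mul_of_nonneg_left h1 hC0
    have h3 := mul_le_mul_of_nonneg_left hY hK
    linarith
  rcases le_or_gt m (xL m R + hLow R (xL m R)) with hL | hL
  · have hb : xBarU m rl rh R C = xL m R := if_pos hL
    rw [hb]
    refine hcapped _ ?_ (min_hLow_xL_le_min hcomp hne m hxR)
    rcases min_cases (hLow R (xL m R)) m with h | h <;> linarith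
  · have hLm : hLow R (xL m R) < m := by linarith
    have hslope : ∀ w, xBarU m rl rh R C < w → w ≤ xMax R → hLow R w < m → _ := fun w =>
      mul_sub_xBarU_le hne hconv hcomp hquad hrl hrh hC1 hL
    set b := xBarU m rl rh R C
    have hbY := min_le_min_right m (hLow_monotone hne hconv hcomp hLm hLb hbx.le hx)
    rcases le_or_gt m (b + min (hLow R b) m) with hb | hb
    · exact hcapped b hb hbY
    · have hbm : min (hLow R b) m = hLow R b := by
        rcases min_cases (hLow R b) m with h | h
        · exact h.1
        · linarith
      unfold forcedLow
      rw [min_eq_left (a := b) (b := m - min (hLow R b) m) (by linarith)]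
      -- Only v units of low demand count at x. The slope estimate is applied at v rather than x,
      -- since the capacity may bind in between.
      set v := min x (m - min (hLow R x) m)
      have h3 := mul_le_mul_of_nonneg_left hbY hK
      rcases le_or_gt v b with hv | hv
      · have h2 := mul_le_mul_of_nonneg_left hv hC0
        linarith
      · have hvx : v ≤ x := min_le_left _ _
        have hvY : v ≤ m - min (hLow R x) m := min_le_right _ _
        have hmono := min_le_min_right m
          (hLow_monotone hne hconv hcomp hLm (hLb.trans hv.le) hvx hx)
        have hvm : min (hLow R v) m = hLow R v ∧ hLow R v < m := by
          rcases min_cases (hLow R v) m with h | h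
          · exact ⟨h.1, by linarith⟩
          · linarith
        have h4 := hslope v hv (hvx.trans hx) hvm.2
        have h5 := mul_le_mul_of_nonneg_left hmono hK
        rw [hvm.1] at h5
        rw [hbm]
        linarith

/-- Beyond `xBarU` the frozen bound is at most the pointwise one because `forcedLow` is no larger
there than at `xBarU`; conversely, p itself does not increase. -/
lemma uBound_iff (hne : R.Nonempty) (hconv : Convex ℝ R) (hcomp : IsCompact R)
    (hquad : ∀ z ∈ R, 0 ≤ z.1 ∧ 0 ≤ z.2) (hm : 0 < m) (hrl : 0 < rl) (hrh : rl < rh)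
    (hC : C ∈ Icc (0 : ℝ) 1) {p : ℝ → ℝ} (hp : AntitoneOn p (Icc 0 (xMax R))) :
    (∀ x ∈ Icc (xMin R) (xMax R), p x ≤ uBound m rl rh R C x) ↔
      ∀ x ∈ Icc (xMin R) (xMax R), p x ≤ m - max (forcedLow m rl rh C x (hLow R x)) 0 := by
  have hbI : xBarU m rl rh R C ∈ Icc (xMin R) (xMax R) :=
    ⟨(xL_mem_Icc hcomp hne m).1.trans (xL_le_xBarU hcomp hne), xBarU_le_xMax hcomp hne⟩
  have hu : ∀ x ∈ Icc (xMin R) (xMax R),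
      uEq m rl rh R C x = m - max (forcedLow m rl rh C x (hLow R x)) 0 := fun x hx =>
    uEq_eq hm hrl hrh hC (hquad _ (hLow_mem hne hconv hcomp hx)).1
      (hquad _ (hLow_mem hne hconv hcomp hx)).2
  constructor
  · intro h x hx
    have h1 := h x hx
    unfold uBound at h1
    rw [if_neg (not_lt.2 hx.1)] at h1
    split_ifs at h1 with hb
    · rwa [hu x hx] at h1
    · rw [hu _ hbI] at h1
      have := forcedLow_le_forcedLow_xBarU hne hconv hcomp hquad hrl hrh hC (not_le.1 hb) hx.2
      linarith [max_le_max_right 0 this]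
  · intro h x hx
    unfold uBound
    rw [if_neg (not_lt.2 hx.1)]
    split_ifs with hb
    · rw [hu x hx]
      exact h x hx
    · rw [hu _ hbI]
      have h0 : 0 ≤ xBarU m rl rh R C := (hquad _ (hLow_mem hne hconv hcomp hbI)).1
      exact (hp ⟨h0, hbI.2⟩ ⟨h0.trans (not_le.1 hb).le, hx.2⟩ (not_le.1 hb).le).trans (h _ hbI)

end PointwiseBounds

/-! ### The modified lower bound -/

section LowerBound

variable {m rl rh C : ℝ} {R : Set (ℝ × ℝ)}

/-- Adding x turns the threshold slope -1 into slope 0, so steepness becomes a question about where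
a concave function stops increasing. -/
lemma concaveOn_criticalLevel_add (hne : R.Nonempty) (hconv : Convex ℝ R) (hcomp : IsCompact R)
    (hC0 : 0 ≤ C) :
    ConcaveOn ℝ (Icc (xMin R) (xMax R)) fun x => criticalLevel m rl rh C (hUp R x) + x := by
  have h1 := (concaveOn_min_hUp hne hconv hcomp m).smul hC0
  have h2 := (h1.add_const (-((1 - C) * m * rl / (rh - rl)))).add (concaveOn_id (convex_Icc _ _))
  refine h2.congr fun x _ => ?_
  simp [criticalLevel, sub_eq_add_neg]

lemma criticalLevel_antitone (hne : R.Nonempty) (hconv : Convex ℝ R) (hcomp : IsCompact R)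
    (hC0 : 0 ≤ C) {s x : ℝ} (hs : xH m R ≤ s) (hsx : s ≤ x) (hx : x ≤ xMax R) :
    criticalLevel m rl rh C (hUp R x) ≤ criticalLevel m rl rh C (hUp R s) :=
  sub_le_sub_right
    (mul_le_mul_of_nonneg_left (min_hUp_antitone hne hconv hcomp hs hsx hx) hC0) _

lemma lBound_of_le {x : ℝ} (hx : x ≤ xH m R) :
    lBound m rl rh R C x = lEq m rl rh R C (xH m R) := if_pos hx

lemma lBound_eq (hne : R.Nonempty) (hconv : Convex ℝ R) (hcomp : IsCompact R)
    (hquad : ∀ z ∈ R, 0 ≤ z.1 ∧ 0 ≤ z.2) (hm : 0 < m) (hrl : 0 < rl) (hrh : rl < rh)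
    (hC : C ∈ Icc (0 : ℝ) 1) {x : ℝ} (hx : x ∈ Icc (xH m R) (xMax R)) :
    lBound m rl rh R C x =
      if max (m - x) 0 < criticalLevel m rl rh C (hUp R x)
      then criticalLevel m rl rh C (hUp R x) else 0 := by
  have hz := hquad _ (hUp_mem hne hconv hcomp ⟨(xH_mem_Icc hcomp hne m).1.trans hx.1, hx.2⟩)
  have h : lBound m rl rh R C x = lEq m rl rh R C x := by
    unfold lBound
    split_ifs with h
    · rw [le_antisymm h hx.1]
    · rfl
  rw [h, lEq_eq hm hrl hrh hC hz.1 hz.2]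

lemma le_of_hasDerivWithinAt_Iio {f : ℝ → ℝ} {d c s : ℝ} (hd : HasDerivWithinAt f d (Iio s) s)
    (h : ∀ᶠ t in nhdsWithin s (Iio s), c * (s - t) ≤ f s - f t) : c ≤ d := by
  have ht := (hasDerivWithinAt_iff_tendsto_slope' self_notMem_Iio).mp hd
  refine ge_of_tendsto ht ?_
  filter_upwards [h, self_mem_nhdsWithin] with t h1 h2
  rw [slope_comm, slope_def_field, le_div_iff₀ (sub_pos.2 h2)]
  exact h1

/-- Beyond a steep point the level required by the upper envelope falls at least at unit rate. -/
lemma criticalLevel_add_le_of_mem_steepSet (hne : R.Nonempty) (hconv : Convex ℝ R)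
    (hcomp : IsCompact R) (hquad : ∀ z ∈ R, 0 ≤ z.1 ∧ 0 ≤ z.2) (hm : 0 < m) (hrl : 0 < rl)
    (hrh : rl < rh) (hC : C ∈ Icc (0 : ℝ) 1) {s x : ℝ} (hs : s ∈ steepSet m rl rh R C)
    (hsx : s < x) (hx : x ≤ xMax R) (hfx : max (m - x) 0 < criticalLevel m rl rh C (hUp R x)) :
    criticalLevel m rl rh C (hUp R x) + x ≤ criticalLevel m rl rh C (hUp R s) + s := by
  obtain ⟨hsI, d, hd, hd1⟩ := hs
  by_contra! hlt
  have hHI := xH_mem_Icc hcomp hne m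
  have hl : ∀ t ∈ Icc (xH m R) (xMax R), _ := fun t =>
    lBound_eq hne hconv hcomp hquad hm hrl hrh hC
  have hanti : ∀ t, xH m R ≤ t → t ≤ s → criticalLevel m rl rh C (hUp R s) ≤
      criticalLevel m rl rh C (hUp R t) := fun t h1 h2 =>
    criticalLevel_antitone hne hconv hcomp hC.1 h1 h2 hsI.2
  have hfs : criticalLevel m rl rh C (hUp R x) ≤ criticalLevel m rl rh C (hUp R s) :=
    criticalLevel_antitone hne hconv hcomp hC.1 hsI.1 hsx.le hx
  obtain ⟨-, hfx0⟩ := max_lt_iff.1 hfx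
  have hcave := concaveOn_criticalLevel_add (m := m) (rl := rl) (rh := rh) hne hconv hcomp hC.1
  set f := fun t => criticalLevel m rl rh C (hUp R t)
  change f x + x > f s + s at hlt
  change 0 < f x at hfx0
  change f x ≤ f s at hfs
  -- If f + id rises from s to x, by concavity it also rises up to s. Left difference quotients of l
  -- at s then stay above some c > -1, contradicting steepness.
  have hkey : ∃ c, -1 < c ∧ ∀ᶠ t in nhdsWithin s (Iio s),
      c * (s - t) ≤ lBound m rl rh R C s - lBound m rl rh R C t := by
    rcases eq_or_lt_of_le hsI.1 with hHs | hHs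
    · refine ⟨0, by norm_num, ?_⟩
      filter_upwards [self_mem_nhdsWithin] with t ht
      rw [lBound_of_le hHs.ge, lBound_of_le ((le_of_lt ht).trans hHs.ge)]
      simp
    · set κ := (f x + x - (f s + s)) / (x - s)
      have hκ : 0 < κ := div_pos (by linarith) (by linarith)
      refine ⟨min (κ - 1) 0, lt_min (by linarith) (by norm_num), ?_⟩
      filter_upwards [Ioo_mem_nhdsLT hHs] with t ht
      have hst : 0 < s - t := sub_pos.2 ht.2
      have htI : t ∈ Icc (xH m R) (xMax R) := ⟨ht.1.le, ht.2.le.trans hsI.2⟩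
      have hslope : κ ≤ (f s + s - (f t + t)) / (s - t) :=
        hcave.slope_anti_adjacent ⟨hHI.1.trans htI.1, htI.2⟩ ⟨hHI.1.trans (hsI.1.trans hsx.le), hx⟩
          ht.2 hsx
      rw [le_div_iff₀ hst] at hslope
      have hκst := mul_pos hκ hst
      have hft : f s ≤ f t := hanti t ht.1.le ht.2.le
      rw [hl s hsI, hl t htI]
      change _ ≤ (if max (m - s) 0 < f s then f s else 0) - (if max (m - t) 0 < f t then f t else 0)
      by_cases hs1 : max (m - s) 0 < f s
      · rw [if_pos hs1]
        have h1 : (if max (m - t) 0 < f t then f t else 0) ≤ f t := by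
          split_ifs
          · exact le_rfl
          · linarith
        have h2 := mul_le_mul_of_nonneg_right (min_le_left (κ - 1) 0) hst.le
        linarith
      -- Here l(s) = 0, and since f + id increases up to s, l vanishes just left of s too.
      · have hms : f s ≤ m - s := by
          rcases le_max_iff.1 (not_lt.1 hs1) with h | h
          · exact h
          · linarith
        rw [if_neg hs1, if_neg (not_lt.2 (le_max_of_le_left (by linarith)))]
        have h2 := mul_le_mul_of_nonneg_right (min_le_right (κ - 1) 0) hst.le
        linarith
  obtain ⟨c, hc, hev⟩ := hkey
  linarith [le_of_hasDerivWithinAt_Iio hd hev]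

lemma steepSet_bddBelow : BddBelow (steepSet m rl rh R C) := ⟨xH m R, fun _ hs => hs.1.1⟩

lemma xNegOne_mem_Icc (hcomp : IsCompact R) (hne : R.Nonempty) :
    xNegOne m rl rh R C ∈ Icc (xH m R) (xMax R) := by
  unfold xNegOne
  split_ifs with h
  · obtain ⟨s, hs⟩ := h
    exact ⟨le_csInf ⟨s, hs⟩ fun t ht => ht.1.1, (csInf_le steepSet_bddBelow hs).trans hs.1.2⟩
  · exact right_mem_Icc.2 (xH_mem_Icc hcomp hne m).2

/-- The infimum of the steep points need not be steep itself; the inequality reaches it through the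
closed projection of a compact part of the region. -/
lemma criticalLevel_add_le_xNegOne (hne : R.Nonempty) (hconv : Convex ℝ R)
    (hcomp : IsCompact R) (hquad : ∀ z ∈ R, 0 ≤ z.1 ∧ 0 ≤ z.2) (hm : 0 < m) (hrl : 0 < rl)
    (hrh : rl < rh) (hC : C ∈ Icc (0 : ℝ) 1) {x : ℝ} (hbx : xNegOne m rl rh R C < x)
    (hx : x ≤ xMax R) (hfx : max (m - x) 0 < criticalLevel m rl rh C (hUp R x)) :
    criticalLevel m rl rh C (hUp R x) + x ≤
      criticalLevel m rl rh C (hUp R (xNegOne m rl rh R C)) + xNegOne m rl rh R C := by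
  have hHI := xH_mem_Icc hcomp hne m
  have hn : (steepSet m rl rh R C).Nonempty := by
    by_contra hn
    exact (hbx.trans_le hx).ne (if_neg hn)
  have hb : xNegOne m rl rh R C = sInf (steepSet m rl rh R C) := if_pos hn
  set b := xNegOne m rl rh R C
  let T : Set (ℝ × ℝ) :=
    R ∩ {z | criticalLevel m rl rh C (hUp R x) + x ≤ criticalLevel m rl rh C z.2 + z.1}
  have hcont : Continuous (criticalLevel m rl rh C) := by
    unfold criticalLevel
    fun_prop
  have hT : IsClosed (Prod.fst '' T) :=
    ((hcomp.inter_right (isClosed_le continuous_const (by fun_prop))).image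
      continuous_fst).isClosed
  have hsub : steepSet m rl rh R C ∩ Iio x ⊆ Prod.fst '' T := by
    rintro s ⟨hs, hsx⟩
    exact ⟨(s, hUp R s), ⟨hUp_mem hne hconv hcomp ⟨hHI.1.trans hs.1.1, hs.1.2⟩,
      criticalLevel_add_le_of_mem_steepSet hne hconv hcomp hquad hm hrl hrh hC hs hsx hx hfx⟩, rfl⟩
  have hcl : b ∈ closure (steepSet m rl rh R C ∩ Iio x) := by
    rw [Metric.mem_closure_iff]
    intro ε hε
    obtain ⟨s, hs, hlt⟩ := exists_lt_of_csInf_lt hn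
      (hb ▸ lt_min hbx (lt_add_of_pos_right b hε) : sInf (steepSet m rl rh R C) < min x (b + ε))
    refine ⟨s, ⟨hs, hlt.trans_le (min_le_left _ _)⟩, ?_⟩
    have h1 : b ≤ s := hb ▸ csInf_le steepSet_bddBelow hs
    rw [Real.dist_eq, abs_sub_comm, abs_of_nonneg (by linarith)]
    linarith [hlt.trans_le (min_le_right _ _)]
  obtain ⟨⟨b', y⟩, ⟨hyR, hy⟩, hb'⟩ := hT.closure_subset_iff.2 hsub hcl
  change b' = b at hb'
  subst hb'
  refine hy.trans (add_le_add_left (sub_le_sub_right (mul_le_mul_of_nonneg_left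
    (min_le_min_right _ (le_hUp hcomp hyR)) hC.1) _) _)

/-- If the constraint at x beyond `xNegOne` is active, it is active at `xNegOne` as well, and the
line of slope -1 from there lies above the critical level at x. Conversely, p falls at most at unit
rate, so it stays above that line. -/
lemma lTilde_iff (hne : R.Nonempty) (hconv : Convex ℝ R) (hcomp : IsCompact R)
    (hquad : ∀ z ∈ R, 0 ≤ z.1 ∧ 0 ≤ z.2) (hm : 0 < m) (hrl : 0 < rl) (hrh : rl < rh)
    (hC : C ∈ Icc (0 : ℝ) 1) {p : ℝ → ℝ} (hp : ValidPL m (xMax R) p) :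
    (∀ x ∈ Icc (xMin R) (xMax R), lTilde m rl rh R C x ≤ p x) ↔
      ∀ x ∈ Icc (xH m R) (xMax R), criticalLevel m rl rh C (hUp R x) ≤ max (m - x) 0 ∨
        criticalLevel m rl rh C (hUp R x) ≤ p x := by
  obtain ⟨hmaps, hanti, hlip⟩ := hp
  have hHI := xH_mem_Icc hcomp hne m
  have hbI : xNegOne m rl rh R C ∈ Icc (xH m R) (xMax R) := xNegOne_mem_Icc hcomp hne
  have h0 : 0 ≤ xMin R := by
    have := (hquad _ (hUp_mem hne hconv hcomp (left_mem_Icc.2 (hHI.1.trans hHI.2)))).1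
    exact this
  have hl : ∀ t ∈ Icc (xH m R) (xMax R), _ := fun t =>
    lBound_eq hne hconv hcomp hquad hm hrl hrh hC
  have hkey : ∀ x, xNegOne m rl rh R C < x → x ≤ xMax R →
      max (m - x) 0 < criticalLevel m rl rh C (hUp R x) → _ := fun x =>
    criticalLevel_add_le_xNegOne hne hconv hcomp hquad hm hrl hrh hC
  unfold lTilde
  set b := xNegOne m rl rh R C
  constructor
  · intro h x hx
    rw [or_iff_not_imp_left, not_le]
    intro hfx
    have h1 := h x ⟨hHI.1.trans hx.1, hx.2⟩
    split_ifs at h1 with hxb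
    · rwa [hl x hx, if_pos hfx] at h1
    · have hxb := not_le.1 hxb
      have h2 := hkey x hxb hx.2 hfx
      obtain ⟨h3, h4⟩ := max_lt_iff.1 hfx
      have h5 : criticalLevel m rl rh C (hUp R x) ≤ criticalLevel m rl rh C (hUp R b) :=
        criticalLevel_antitone hne hconv hcomp hC.1 hbI.1 hxb.le hx.2
      have h6 : max (m - b) 0 < criticalLevel m rl rh C (hUp R b) :=
        max_lt (by linarith) (by linarith)
      rw [hl b hbI, if_pos h6] at h1
      linarith [(le_max_left _ _).trans h1]
  · intro h
    have hge : ∀ x ∈ Icc (xH m R) (xMax R), lBound m rl rh R C x ≤ p x := by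
      intro x hx
      rw [hl x hx]
      split_ifs with hfx
      · exact (h x hx).resolve_left (not_le.2 hfx)
      · exact (hmaps ⟨h0.trans (hHI.1.trans hx.1), hx.2⟩).1
    intro x hx
    have hx0 : x ∈ Icc 0 (xMax R) := ⟨h0.trans hx.1, hx.2⟩
    split_ifs with hxb
    · rcases le_total x (xH m R) with hxH | hxH
      · rw [lBound_of_le hxH, ← lBound_of_le le_rfl]
        exact (hge _ ⟨le_rfl, hHI.2⟩).trans (hanti hx0 ⟨h0.trans hHI.1, hHI.2⟩ hxH)
      · exact hge x ⟨hxH, hx.2⟩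
    · have hxb := not_le.1 hxb
      refine max_le ?_ (hmaps hx0).1
      have h1 := hge b hbI
      have h2 := hlip.dist_le_mul b ⟨h0.trans (hHI.1.trans hbI.1), hbI.2⟩ x hx0
      rw [Real.dist_eq, Real.dist_eq, abs_sub_comm b x, abs_of_pos (sub_pos.2 hxb)] at h2
      have h3 := (le_abs_self _).trans h2
      simp only [NNReal.coe_one, one_mul] at h3
      linarith

end LowerBound

/-! ## Compactness of the valid protection level functions and attainment of the maximum -/

section Attainment

/-- Functions with values in `[0, m]` everywhere that are valid on `[0, X]`. -/
def validSet (m X : ℝ) : Set (ℝ → ℝ) :=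
  univ.pi (fun _ => Icc 0 m) ∩
    {p | ∀ x ∈ Icc 0 X, ∀ x' ∈ Icc 0 X, x ≤ x' → p x - (x' - x) ≤ p x' ∧ p x' ≤ p x}

/-- Tychonoff: monotonicity and the slope bound compare values at two points, hence are closed for
pointwise convergence. -/
lemma isCompact_validSet (m X : ℝ) : IsCompact (validSet m X) := by
  refine (isCompact_univ_pi fun _ => isCompact_Icc).inter_right ?_
  simp only [ofPred_forall, ofPred_and]
  refine isClosed_iInter fun x => isClosed_iInter fun _ => isClosed_iInter fun x' =>
    isClosed_iInter fun _ => isClosed_iInter fun _ => IsClosed.inter ?_ ?_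
  · exact isClosed_le (by fun_prop) (by fun_prop)
  · exact isClosed_le (by fun_prop) (by fun_prop)

lemma validPL_of_mem_validSet {m X : ℝ} {p : ℝ → ℝ} (hp : p ∈ validSet m X) : ValidPL m X p := by
  refine ⟨fun x _ => hp.1 x (mem_univ x), fun x hx y hy hxy => (hp.2 x hx y hy hxy).2, ?_⟩
  refine LipschitzOnWith.of_dist_le_mul fun x hx y hy => ?_
  rw [NNReal.coe_one, one_mul, Real.dist_eq, Real.dist_eq]
  rcases le_total x y with h | h
  · have := hp.2 x hx y hy h
    rw [abs_of_nonneg (by linarith), abs_of_nonpos (by linarith)]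
    linarith
  · have := hp.2 y hy x hx h
    rw [abs_of_nonpos (by linarith), abs_of_nonneg (by linarith)]
    linarith

lemma exists_mem_validSet_eqOn {m X : ℝ} (hm : 0 < m) {p : ℝ → ℝ} (hp : ValidPL m X p) :
    ∃ q ∈ validSet m X, EqOn q p (Icc 0 X) := by
  classical
  obtain ⟨hmaps, hanti, hlip⟩ := hp
  refine ⟨(Icc 0 X).indicator p, ⟨fun x _ => ?_, fun x hx y hy hxy => ?_⟩,
    fun x hx => indicator_of_mem hx p⟩
  · by_cases hx : x ∈ Icc 0 X
    · rw [indicator_of_mem hx]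
      exact hmaps hx
    · rw [indicator_of_notMem hx]
      exact ⟨le_rfl, hm.le⟩
  · rw [indicator_of_mem hx, indicator_of_mem hy]
    refine ⟨?_, hanti hx hy hxy⟩
    have h2 := hlip.dist_le_mul x hx y hy
    rw [Real.dist_eq, Real.dist_eq, abs_sub_comm x y, abs_of_nonneg (sub_nonneg.2 hxy),
      NNReal.coe_one, one_mul] at h2
    linarith [(le_abs_self _).trans h2]

/-- Protection levels for which every point of the two envelopes that matters has compatible ratio
at least `C`. -/
def LevelCompatible (m rl rh : ℝ) (R : Set (ℝ × ℝ)) (C : ℝ) (p : ℝ → ℝ) : Prop :=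
  (∀ x ∈ Icc (xMin R) (xMax R), p x ≤ m - max (forcedLow m rl rh C x (hLow R x)) 0) ∧
    ∀ x ∈ Icc (xH m R) (xMax R), criticalLevel m rl rh C (hUp R x) ≤ max (m - x) 0 ∨
      criticalLevel m rl rh C (hUp R x) ≤ p x

/-- The jump of l is harmless because the condition is a union of two non-strict inequalities. -/
lemma isClosed_levelCompatible (m rl rh : ℝ) (R : Set (ℝ × ℝ)) :
    IsClosed {q : ℝ × (ℝ → ℝ) | LevelCompatible m rl rh R q.1 q.2} := by
  simp only [LevelCompatible, ofPred_forall, ofPred_and, ofPred_or, forcedLow, criticalLevel]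
  refine IsClosed.inter ?_ ?_
  · exact isClosed_iInter fun x => isClosed_iInter fun _ => isClosed_le (by fun_prop) (by fun_prop)
  · exact isClosed_iInter fun x => isClosed_iInter fun _ => IsClosed.union
      (isClosed_le (by fun_prop) (by fun_prop)) (isClosed_le (by fun_prop) (by fun_prop))

variable {m rl rh C : ℝ} {R : Set (ℝ × ℝ)}

lemma xMin_nonneg (hne : R.Nonempty) (hquad : ∀ z ∈ R, 0 ≤ z.1 ∧ 0 ≤ z.2) : 0 ≤ xMin R := by
  refine le_csInf (hne.image _) ?_
  rintro _ ⟨z, hz, rfl⟩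
  exact (hquad z hz).1

lemma LevelCompatible.congr (hcomp : IsCompact R) (hne : R.Nonempty)
    (hquad : ∀ z ∈ R, 0 ≤ z.1 ∧ 0 ≤ z.2) {p q : ℝ → ℝ} (hqp : EqOn q p (Icc 0 (xMax R)))
    (h : LevelCompatible m rl rh R C p) : LevelCompatible m rl rh R C q := by
  have h0 := xMin_nonneg hne hquad
  refine ⟨fun x hx => ?_, fun x hx => ?_⟩
  · rw [hqp ⟨h0.trans hx.1, hx.2⟩]
    exact h.1 x hx
  · rw [hqp ⟨h0.trans ((xH_mem_Icc hcomp hne m).1.trans hx.1), hx.2⟩]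
    exact h.2 x hx

lemma mem_feasibleRatios_iff (hne : R.Nonempty) (hconv : Convex ℝ R) (hcomp : IsCompact R)
    (hquad : ∀ z ∈ R, 0 ≤ z.1 ∧ 0 ≤ z.2) (hm : 0 < m) (hrl : 0 < rl) (hrh : rl < rh) :
    C ∈ feasibleRatios m rl rh R ↔ C ∈ Icc (0 : ℝ) 1 ∧
      ∃ p, ValidPL m (xMax R) p ∧ LevelCompatible m rl rh R C p := by
  refine and_congr_right fun hC => exists_congr fun p => and_congr_right fun hp => ?_
  rw [LevelCompatible, ← lTilde_iff hne hconv hcomp hquad hm hrl hrh hC hp,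
    ← uBound_iff hne hconv hcomp hquad hm hrl hrh hC hp.2.1]
  exact ⟨fun h => ⟨fun x hx => (h x hx).2, fun x hx => (h x hx).1⟩,
    fun h x hx => ⟨h.2 x hx, h.1 x hx⟩⟩

lemma isCompact_feasibleRatios (hne : R.Nonempty) (hconv : Convex ℝ R) (hcomp : IsCompact R)
    (hquad : ∀ z ∈ R, 0 ≤ z.1 ∧ 0 ≤ z.2) (hm : 0 < m) (hrl : 0 < rl) (hrh : rl < rh) :
    IsCompact (feasibleRatios m rl rh R) := by
  have h : feasibleRatios m rl rh R = Prod.fst '' ((Icc (0 : ℝ) 1 ×ˢ validSet m (xMax R)) ∩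
      {q : ℝ × (ℝ → ℝ) | LevelCompatible m rl rh R q.1 q.2}) := by
    ext C
    rw [mem_feasibleRatios_iff hne hconv hcomp hquad hm hrl hrh]
    constructor
    · rintro ⟨hC, p, hp, hcp⟩
      obtain ⟨q, hq, hqp⟩ := exists_mem_validSet_eqOn hm hp
      exact ⟨(C, q), ⟨⟨hC, hq⟩, hcp.congr hcomp hne hquad hqp⟩, rfl⟩
    · rintro ⟨⟨C, p⟩, ⟨⟨hC, hp⟩, hcp⟩, rfl⟩
      exact ⟨hC, p, validPL_of_mem_validSet hp, hcp⟩
  rw [h]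
  exact ((isCompact_Icc.prod (isCompact_validSet m (xMax R))).inter_right
    (isClosed_levelCompatible m rl rh R)).image continuous_fst

/-- The ratio of the optimal algorithm without predictions is always feasible. -/
lemma inv_two_sub_mem_feasibleRatios (hne : R.Nonempty) (hconv : Convex ℝ R)
    (hcomp : IsCompact R) (hquad : ∀ z ∈ R, 0 ≤ z.1 ∧ 0 ≤ z.2) (hm : 0 < m) (hrl : 0 < rl)
    (hrh : rl < rh) : 1 / (2 - rl / rh) ∈ feasibleRatios m rl rh R := by
  have hrh0 : 0 < rh := hrl.trans hrh
  have ha : rl / rh < 1 := (div_lt_one hrh0).2 hrh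
  have hρ0 : 0 ≤ 1 / (2 - rl / rh) := div_nonneg zero_le_one (by linarith)
  have hρ1 : 1 / (2 - rl / rh) ≤ 1 := (div_le_one (by linarith)).2 (by linarith)
  have hρ : 1 / (2 - rl / rh) * (rh - rl) = (1 - 1 / (2 - rl / rh)) * rl
      + (1 - 1 / (2 - rl / rh)) * (rh - rl) := by
    have : 2 - rl / rh ≠ 0 := by linarith
    have : 2 * rh - rl ≠ 0 := by linarith
    field_simp
    ring
  set ρ := 1 / (2 - rl / rh)
  have hC : ρ ∈ Icc (0 : ℝ) 1 := ⟨hρ0, hρ1⟩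
  -- This level leaves ρm for low requests, the most `forcedLow` can require; by `hρ` it is also the
  -- critical level for high demand m.
  refine (mem_feasibleRatios_iff hne hconv hcomp hquad hm hrl hrh).2
    ⟨hC, fun _ => m * (1 - ρ), ⟨fun x _ => ⟨mul_nonneg hm.le (by linarith), ?_⟩,
      antitoneOn_const, LipschitzOnWith.of_dist_le_mul fun x _ y _ => by simp⟩,
      fun x hx => ?_, fun x hx => Or.inr ?_⟩
  · exact mul_le_of_le_one_right hm.le (by linarith)
  · have h1 := forcedLow_le hm hrl hrh hC x (hquad _ (hLow_mem hne hconv hcomp hx)).2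
    have h2 := h1.trans (mul_le_mul_of_nonneg_left (min_le_right x m) hρ0)
    have h3 : max (forcedLow m rl rh ρ x (hLow R x)) 0 ≤ ρ * m := max_le h2 (mul_nonneg hρ0 hm.le)
    linarith
  · have h1 : ρ * min (hUp R x) m ≤ ρ * m := mul_le_mul_of_nonneg_left (min_le_right _ _) hρ0
    have h2 : (1 - ρ) * m * rl / (rh - rl) = m * ρ - m * (1 - ρ) := by
      rw [div_eq_iff (by linarith)]
      linear_combination (-m) * hρ
    unfold criticalLevel
    linarith

end Attainment

/-! ## Rewards along arrival sequences -/

section Rewards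

lemma sum_take_get_append_singleton {α : Type*} (F : List α → α → ℝ) (I : List α) (r : α) :
    ∑ t : Fin (I ++ [r]).length, F ((I ++ [r]).take t) ((I ++ [r]).get t) =
      (∑ t : Fin I.length, F (I.take t) (I.get t)) + F I r := by
  have hlen : (I ++ [r]).length = I.length + 1 := by simp
  rw [← (finCongr hlen).symm.sum_comp, Fin.sum_univ_castSucc]
  congr 1
  · refine Finset.sum_congr rfl fun t _ => ?_
    simp [List.take_append_of_le_length t.2.le]
  · simp

lemma sum_get {α : Type*} (g : α → ℝ) (I : List α) :
    ∑ t : Fin I.length, g (I.get t) = (I.map g).sum := by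
  induction I using List.reverseRecOn with
  | nil => simp
  | append_singleton I r ih =>
    rw [sum_take_get_append_singleton (fun _ => g), ih]
    simp

lemma lowDemand_append (I J : List Request) :
    lowDemand (I ++ J) = lowDemand I + lowDemand J := by simp [lowDemand]

lemma highDemand_append (I J : List Request) :
    highDemand (I ++ J) = highDemand I + highDemand J := by simp [highDemand]

lemma Request.lowSize_nonneg (r : Request) : 0 ≤ r.lowSize := by
  rcases r with ⟨s, k, hs⟩
  cases k
  · exact hs.le
  · exact le_rfl

lemma Request.highSize_nonneg (r : Request) : 0 ≤ r.highSize := by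
  rcases r with ⟨s, k, hs⟩
  cases k
  · exact le_rfl
  · exact hs.le

lemma lowDemand_nonneg (I : List Request) : 0 ≤ lowDemand I :=
  List.sum_nonneg (by simpa using fun r _ => r.lowSize_nonneg)

lemma highDemand_nonneg (I : List Request) : 0 ≤ highDemand I :=
  List.sum_nonneg (by simpa using fun r _ => r.highSize_nonneg)

/-- Total amount allocated by an online algorithm. -/
def OnlineAlgorithm.total {m : ℝ} (A : OnlineAlgorithm m) (I : List Request) : ℝ :=
  ∑ t : Fin I.length, A.alloc (I.take t) (I.get t)

variable {m rl rh : ℝ}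

lemma OnlineAlgorithm.total_append_singleton (A : OnlineAlgorithm m) (I : List Request)
    (r : Request) : A.total (I ++ [r]) = A.total I + A.alloc I r :=
  sum_take_get_append_singleton A.alloc I r

lemma OnlineAlgorithm.total_nonneg (A : OnlineAlgorithm m) (I : List Request) : 0 ≤ A.total I :=
  Finset.sum_nonneg fun _ _ => A.alloc_nonneg _ _

lemma OnlineAlgorithm.total_le (A : OnlineAlgorithm m) (I : List Request) : A.total I ≤ m :=
  A.capacity I

lemma OnlineAlgorithm.reward_append_singleton (A : OnlineAlgorithm m) (I : List Request)
    (r : Request) :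
    A.reward rl rh (I ++ [r]) = A.reward rl rh I + A.alloc I r * r.kind.reward rl rh :=
  sum_take_get_append_singleton (fun J r => A.alloc J r * r.kind.reward rl rh) I r

/-- Requests of low type only. -/
def AllLow (I : List Request) : Prop := ∀ r ∈ I, r.kind = Kind.low

lemma AllLow.highDemand_eq {I : List Request} (h : AllLow I) : highDemand I = 0 := by
  refine List.sum_eq_zero ?_
  simp only [List.mem_map, forall_exists_index, and_imp, forall_apply_eq_imp_iff₂]
  intro r hr
  simp [Request.highSize, h r hr]

lemma AllLow.reward_eq {I : List Request} (h : AllLow I) (A : OnlineAlgorithm m) :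
    A.reward rl rh I = A.total I * rl := by
  unfold OnlineAlgorithm.reward OnlineAlgorithm.total
  rw [Finset.sum_mul]
  refine Finset.sum_congr rfl fun t _ => ?_
  rw [h _ (List.get_mem I t)]
  rfl

/-- Source of monotonicity and of the slope bound: allocations are irrevocable and never exceed the
request. -/
lemma OnlineAlgorithm.total_append_mem (A : OnlineAlgorithm m) (I K : List Request)
    (hK : AllLow K) : A.total (I ++ K) ∈ Icc (A.total I) (A.total I + lowDemand K) := by
  induction K using List.reverseRecOn with
  | nil => simp [lowDemand]
  | append_singleton K r ih =>
    have hr : r.kind = Kind.low := hK r (by simp)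
    have ih := ih fun q hq => hK q (by simp [hq])
    have hs : lowDemand [r] = r.size := by simp [lowDemand, Request.lowSize, hr]
    rw [← List.append_assoc, A.total_append_singleton, lowDemand_append, hs]
    have h1 := A.alloc_nonneg (I ++ K) r
    have h2 := A.alloc_le_size (I ++ K) r
    exact ⟨by linarith [ih.1], by linarith [ih.2]⟩

lemma Kind.reward_nonneg (hrl : 0 < rl) (hrh : rl < rh) (k : Kind) : 0 ≤ k.reward rl rh := by
  cases k
  · exact hrl.le
  · exact (hrl.trans hrh).le

lemma Kind.reward_le (hrh : rl < rh) (k : Kind) : k.reward rl rh ≤ rh := by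
  cases k
  · exact hrh.le
  · exact le_rfl

lemma OnlineAlgorithm.reward_nonneg (hrl : 0 < rl) (hrh : rl < rh) (A : OnlineAlgorithm m)
    (I : List Request) : 0 ≤ A.reward rl rh I :=
  Finset.sum_nonneg fun _ _ => mul_nonneg (A.alloc_nonneg _ _) (Kind.reward_nonneg hrl hrh _)

lemma opt_bddAbove (hrl : 0 < rl) (hrh : rl < rh) (I : List Request) :
    BddAbove {v | ∃ a : Fin I.length → ℝ, (∀ t, 0 ≤ a t ∧ a t ≤ (I.get t).size) ∧ ∑ t, a t ≤ m ∧
      v = ∑ t, a t * (I.get t).kind.reward rl rh} := by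
  refine ⟨m * rh, ?_⟩
  rintro _ ⟨a, ha, hsum, rfl⟩
  calc ∑ t, a t * (I.get t).kind.reward rl rh ≤ ∑ t, a t * rh :=
        Finset.sum_le_sum fun t _ => mul_le_mul_of_nonneg_left (Kind.reward_le hrh _) (ha t).1
    _ = (∑ t, a t) * rh := (Finset.sum_mul ..).symm
    _ ≤ m * rh := mul_le_mul_of_nonneg_right hsum (hrl.trans hrh).le

lemma OnlineAlgorithm.reward_le_opt (hrl : 0 < rl) (hrh : rl < rh) (A : OnlineAlgorithm m)
    (I : List Request) : A.reward rl rh I ≤ opt m rl rh I :=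
  le_csSup (opt_bddAbove hrl hrh I)
    ⟨fun t => A.alloc (I.take t) (I.get t), fun _ => ⟨A.alloc_nonneg _ _, A.alloc_le_size _ _⟩,
      A.capacity I, rfl⟩

/-- Serving the same fraction of all requests of a type is a feasible allocation. -/
lemma le_opt (hm : 0 < m) (hrl : 0 < rl) (hrh : rl < rh) (I : List Request) :
    min (highDemand I) m * rh + min (lowDemand I) (m - min (highDemand I) m) * rl ≤
      opt m rl rh I := by
  have hfrac : ∀ a b : ℝ, 0 ≤ b → b ≤ a → ∃ c ∈ Icc (0 : ℝ) 1, c * a = b := by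
    intro a b hb hba
    rcases eq_or_lt_of_le (hb.trans hba) with ha | ha
    · exact ⟨0, ⟨le_rfl, zero_le_one⟩, by linarith⟩
    · exact ⟨b / a, ⟨div_nonneg hb ha.le, (div_le_one ha).2 hba⟩, div_mul_cancel₀ b ha.ne'⟩
  have hY : 0 ≤ min (highDemand I) m := le_min (highDemand_nonneg I) hm.le
  have hYm : min (highDemand I) m ≤ m := min_le_right _ _
  obtain ⟨μ, hμ, hμe⟩ := hfrac (highDemand I) _ hY (min_le_left _ _)
  obtain ⟨ν, hν, hνe⟩ := hfrac (lowDemand I) (min (lowDemand I) (m - min (highDemand I) m))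
    (le_min (lowDemand_nonneg I) (by linarith)) (min_le_left _ _)
  have hsum : ∀ u v : ℝ, (∑ t : Fin I.length, (u * (I.get t).highSize + v * (I.get t).lowSize)) =
      u * highDemand I + v * lowDemand I := by
    intro u v
    rw [Finset.sum_add_distrib, ← Finset.mul_sum, ← Finset.mul_sum, sum_get, sum_get]
    rfl
  refine le_csSup (opt_bddAbove hrl hrh I)
    ⟨fun t => μ * (I.get t).highSize + ν * (I.get t).lowSize, fun t => ⟨?_, ?_⟩, ?_, ?_⟩
  · exact add_nonneg (mul_nonneg hμ.1 (Request.highSize_nonneg _))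
      (mul_nonneg hν.1 (Request.lowSize_nonneg _))
  · have h1 := mul_le_of_le_one_left (I.get t).highSize_nonneg hμ.2
    have h2 := mul_le_of_le_one_left (I.get t).lowSize_nonneg hν.2
    have h3 : (I.get t).highSize + (I.get t).lowSize = (I.get t).size := by
      generalize I.get t = r
      rcases r with ⟨s, k, hs⟩
      cases k <;> simp [Request.highSize, Request.lowSize]
    linarith
  · rw [hsum, hμe, hνe]
    linarith [min_le_right (lowDemand I) (m - min (highDemand I) m)]
  · have h : ∀ t : Fin I.length, (μ * (I.get t).highSize + ν * (I.get t).lowSize) *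
        (I.get t).kind.reward rl rh =
        (μ * rh) * (I.get t).highSize + (ν * rl) * (I.get t).lowSize := by
      intro t
      generalize I.get t = r
      rcases r with ⟨s, k, hs⟩
      cases k <;> simp [Request.highSize, Request.lowSize, Kind.reward] <;> ring
    simp only [h]
    rw [hsum]
    linear_combination (-rh) * hμe + (-rl) * hνe

/-- Nested sequences of low requests whose total demands run through a given finite set. -/
lemma exists_nested_low_sequences (F : Finset ℝ) (hF : ∀ x ∈ F, 0 ≤ x) :
    ∃ J : ℝ → List Request, (∀ x ∈ F, AllLow (J x) ∧ lowDemand (J x) = x) ∧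
      ∀ x ∈ F, ∀ x' ∈ F, x ≤ x' → J x <+: J x' := by
  -- The induction carries the longest sequence M so far, to be extended to the new maximum.
  -- Requests have positive size, so a = 0 must reuse M.
  suffices h : ∃ (J : ℝ → List Request) (M : List Request),
      (∀ x ∈ F, AllLow (J x) ∧ lowDemand (J x) = x) ∧
      (∀ x ∈ F, ∀ x' ∈ F, x ≤ x' → J x <+: J x') ∧ AllLow M ∧ (∀ x ∈ F, J x <+: M) ∧
      (lowDemand M = 0 ∨ lowDemand M ∈ F) by
    obtain ⟨J, M, h1, h2, -⟩ := h
    exact ⟨J, h1, h2⟩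
  induction F using Finset.induction_on_max with
  | empty => exact ⟨fun _ => [], [], by simp, by simp, by simp [AllLow], by simp,
      by simp [lowDemand]⟩
  | insert a F ha ih =>
    obtain ⟨J, M, h1, h2, hM, hJM, hM0⟩ := ih fun x hx => hF x (Finset.mem_insert_of_mem hx)
    have ha0 : 0 ≤ a := hF a (Finset.mem_insert_self a F)
    have haF : a ∉ F := fun h => (ha a h).false
    have hMa : lowDemand M ≤ a := by
      rcases hM0 with h | h
      · linarith
      · exact (ha _ h).le
    obtain ⟨N, hN, hMN, hNa⟩ : ∃ N, AllLow N ∧ M <+: N ∧ lowDemand N = a := by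
      rcases eq_or_lt_of_le hMa with h | h
      · exact ⟨M, hM, List.prefix_rfl, h⟩
      · refine ⟨M ++ [⟨a - lowDemand M, Kind.low, sub_pos.2 h⟩], ?_, List.prefix_append _ _, ?_⟩
        · intro r hr
          rcases List.mem_append.1 hr with hr | hr
          · exact hM r hr
          · rw [List.mem_singleton.1 hr]
        · rw [lowDemand_append]
          simp [lowDemand, Request.lowSize]
    have hne : ∀ x ∈ F, x ≠ a := fun x hx h => haF (h ▸ hx)
    refine ⟨Function.update J a N, N, ?_, ?_, hN, ?_, Or.inr (hNa ▸ Finset.mem_insert_self _ _)⟩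
    · intro x hx
      rcases Finset.mem_insert.1 hx with rfl | hx
      · simpa using ⟨hN, hNa⟩
      · simpa [Function.update_of_ne (hne x hx)] using h1 x hx
    · intro x hx x' hx' hxx
      rcases Finset.mem_insert.1 hx' with rfl | hxF'
      · rcases Finset.mem_insert.1 hx with rfl | hx
        · exact List.prefix_rfl
        · simpa [Function.update_of_ne (hne x hx)] using (hJM x hx).trans hMN
      · rcases Finset.mem_insert.1 hx with rfl | hx
        · exact absurd (ha x' hxF') (not_lt.2 hxx)
        · simpa [Function.update_of_ne (hne x hx), Function.update_of_ne (hne x' hxF')] using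
            h2 x hx x' hxF' hxx
    · intro x hx
      rcases Finset.mem_insert.1 hx with rfl | hx
      · simp
      · simpa [Function.update_of_ne (hne x hx)] using (hJM x hx).trans hMN

end Rewards

/-! ## The expected protection level of a consistent algorithm -/

section Expectation

variable {m rl rh C : ℝ} {R : Set (ℝ × ℝ)} {Ω : Type*} [MeasurableSpace Ω] {μ : Measure Ω}

namespace RandomizedAlgorithm

variable (A : RandomizedAlgorithm m Ω)

lemma rew_nonneg (hrl : 0 < rl) (hrh : rl < rh) (I : List Request) : 0 ≤ A.rew rl rh μ I :=
  integral_nonneg fun ω => (A.toAlg ω).reward_nonneg hrl hrh I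

variable [IsProbabilityMeasure μ]

lemma integrable_alloc (past : List Request) (r : Request) :
    Integrable (fun ω => (A.toAlg ω).alloc past r) μ := by
  refine Integrable.of_mem_Icc 0 r.size (A.measurable_alloc past r).aemeasurable ?_
  exact .of_forall fun ω => ⟨(A.toAlg ω).alloc_nonneg _ _, (A.toAlg ω).alloc_le_size _ _⟩

lemma integrable_total (I : List Request) : Integrable (fun ω => (A.toAlg ω).total I) μ :=
  integrable_finsetSum _ fun _ _ => A.integrable_alloc _ _

lemma integrable_reward (I : List Request) :
    Integrable (fun ω => (A.toAlg ω).reward rl rh I) μ :=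
  integrable_finsetSum _ fun _ _ => (A.integrable_alloc _ _).mul_const _

lemma rew_le_opt (hrl : 0 < rl) (hrh : rl < rh) (I : List Request) :
    A.rew rl rh μ I ≤ opt m rl rh I := by
  have h : A.rew rl rh μ I ≤ ∫ _, opt m rl rh I ∂μ :=
    integral_mono (A.integrable_reward I) (integrable_const _)
      fun ω => (A.toAlg ω).reward_le_opt hrl hrh I
  simpa using h

lemma integral_total_mem (I : List Request) :
    ∫ ω, (A.toAlg ω).total I ∂μ ∈ Icc 0 m := by
  refine ⟨integral_nonneg fun ω => (A.toAlg ω).total_nonneg I, ?_⟩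
  have h := integral_mono (μ := μ) (A.integrable_total I) (integrable_const m)
    fun ω => (A.toAlg ω).total_le I
  simpa using h

lemma integral_total_append_mem (I K : List Request) (hK : AllLow K) :
    ∫ ω, (A.toAlg ω).total (I ++ K) ∂μ ∈
      Icc (∫ ω, (A.toAlg ω).total I ∂μ) (∫ ω, (A.toAlg ω).total I ∂μ + lowDemand K) := by
  constructor
  · exact integral_mono (A.integrable_total _) (A.integrable_total _)
      fun ω => ((A.toAlg ω).total_append_mem I K hK).1
  · have h := integral_mono (μ := μ) (A.integrable_total (I ++ K))
      ((A.integrable_total I).add (integrable_const (lowDemand K)))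
      fun ω => ((A.toAlg ω).total_append_mem I K hK).2
    simp only [Pi.add_apply] at h
    rw [integral_add (A.integrable_total I) (integrable_const _)] at h
    simpa using h

lemma perfRatio_rew_mem (hrl : 0 < rl) (hrh : rl < rh) (I : List Request) :
    perfRatio (A.rew rl rh μ I) (opt m rl rh I) ∈ Icc (0 : ℝ) 1 := by
  have h1 := A.rew_nonneg (μ := μ) hrl hrh I
  have h2 := A.rew_le_opt (μ := μ) hrl hrh I
  unfold perfRatio
  split_ifs with h
  · exact ⟨zero_le_one, le_rfl⟩
  · exact ⟨div_nonneg h1 (h1.trans h2), div_le_one_of_le₀ h2 (h1.trans h2)⟩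

lemma consis_le_perfRatio (hrl : 0 < rl) (hrh : rl < rh) {I : List Request}
    (hI : (lowDemand I, highDemand I) ∈ R) :
    consis rl rh R μ A ≤ perfRatio (A.rew rl rh μ I) (opt m rl rh I) := by
  refine csInf_le ⟨0, ?_⟩ (mem_image_of_mem _ hI)
  rintro _ ⟨J, -, rfl⟩
  exact (A.perfRatio_rew_mem hrl hrh J).1

lemma consis_mul_le_rew (hm : 0 < m) (hrl : 0 < rl) (hrh : rl < rh)
    (hC : 0 ≤ consis rl rh R μ A) {I : List Request} (hI : (lowDemand I, highDemand I) ∈ R) :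
    consis rl rh R μ A * (min (highDemand I) m * rh +
      min (lowDemand I) (m - min (highDemand I) m) * rl) ≤ A.rew rl rh μ I := by
  have h1 := A.consis_le_perfRatio (μ := μ) hrl hrh hI
  have h2 := le_opt hm hrl hrh I
  have h3 := A.rew_nonneg (μ := μ) hrl hrh I
  have h4 := A.rew_le_opt (μ := μ) hrl hrh I
  refine (mul_le_mul_of_nonneg_left h2 hC).trans ?_
  rcases eq_or_lt_of_le (h3.trans h4) with h0 | h0
  · rw [← h0, mul_zero]
    exact h3
  · rwa [perfRatio, if_neg h0.ne', le_div_iff₀ h0] at h1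

/-- The key inequality: the expected low-reward allocation `q` made before the high-reward demand
arrives leaves at most `m - q` units for the latter. -/
lemma consis_mul_le (hm : 0 < m) (hrl : 0 < rl) (hrh : rl < rh)
    (hC : 0 ≤ consis rl rh R μ A) {J : List Request} (hJ : AllLow J) {y : ℝ} (hy : 0 ≤ y)
    (hR : (lowDemand J, y) ∈ R) :
    consis rl rh R μ A * (min y m * rh + min (lowDemand J) (m - min y m) * rl) ≤
      min y (m - ∫ ω, (A.toAlg ω).total J ∂μ) * rh + (∫ ω, (A.toAlg ω).total J ∂μ) * rl := by
  have hrh0 : 0 ≤ rh := (hrl.trans hrh).le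
  have hq := A.integral_total_mem (μ := μ) J
  -- No request has size 0, so for y = 0 the sequence stops after the low requests.
  rcases eq_or_lt_of_le hy with rfl | hy
  · have h := A.consis_mul_le_rew (μ := μ) hm hrl hrh hC (I := J) (by rwa [hJ.highDemand_eq])
    rw [hJ.highDemand_eq] at h
    refine h.trans ?_
    have hrew : A.rew rl rh μ J = (∫ ω, (A.toAlg ω).total J ∂μ) * rl := by
      unfold RandomizedAlgorithm.rew
      simp only [hJ.reward_eq]
      exact integral_mul_const _ _
    rw [hrew, min_eq_left (by linarith [hq.2])]
    linarith
  · let r : Request := ⟨y, Kind.high, hy⟩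
    have hlow : lowDemand (J ++ [r]) = lowDemand J := by
      rw [lowDemand_append]
      simp [lowDemand, Request.lowSize, r]
    have hhigh : highDemand (J ++ [r]) = y := by
      rw [highDemand_append, hJ.highDemand_eq]
      simp [highDemand, Request.highSize, r]
    have h := A.consis_mul_le_rew (μ := μ) hm hrl hrh hC (I := J ++ [r])
      (by rwa [hlow, hhigh])
    rw [hlow, hhigh] at h
    refine h.trans ?_
    have hrew : A.rew rl rh μ (J ++ [r]) = (∫ ω, (A.toAlg ω).total J ∂μ) * rl +
        (∫ ω, (A.toAlg ω).alloc J r ∂μ) * rh := by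
      unfold RandomizedAlgorithm.rew
      simp only [OnlineAlgorithm.reward_append_singleton, hJ.reward_eq]
      rw [integral_add ((A.integrable_total J).mul_const _) ((A.integrable_alloc J r).mul_const _),
        integral_mul_const, integral_mul_const]
      rfl
    have h1 : ∫ ω, (A.toAlg ω).alloc J r ∂μ ≤ y := by
      have := integral_mono (μ := μ) (A.integrable_alloc J r) (integrable_const y)
        fun ω => (A.toAlg ω).alloc_le_size J r
      simpa using this
    have h2 : ∫ ω, (A.toAlg ω).total J ∂μ + ∫ ω, (A.toAlg ω).alloc J r ∂μ ≤ m := by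
      have := (A.integral_total_mem (μ := μ) (J ++ [r])).2
      simp only [OnlineAlgorithm.total_append_singleton] at this
      rwa [integral_add (A.integrable_total J) (A.integrable_alloc J r)] at this
    rw [hrew, add_comm]
    exact add_le_add_left (mul_le_mul_of_nonneg_right (le_min h1 (by linarith)) hrh0) _

end RandomizedAlgorithm

/-- High sales are at most min(y, m); low sales must cover the rest. -/
lemma forcedLow_le_of_mul_le (hrl : 0 < rl) (hrh : rl < rh) {x y q : ℝ} (hq : 0 ≤ q)
    (h : C * (min y m * rh + min x (m - min y m) * rl) ≤ min y (m - q) * rh + q * rl) :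
    forcedLow m rl rh C x y ≤ q := by
  have h1 : min y (m - q) * rh ≤ min y m * rh :=
    mul_le_mul_of_nonneg_right (min_le_min_left _ (by linarith)) (hrl.trans hrh).le
  have h2 := forcedLow_mul (m := m) (C := C) (rh := rh) hrl x y
  exact le_of_mul_le_mul_right (by linarith) hrl

/-- If the low demand fits beside the high demand, the first alternative is automatic. Otherwise the
optimum uses all of m, and bounding high sales by m - q gives the second. -/
lemma criticalLevel_le_of_mul_le (hm : 0 < m) (hrl : 0 < rl) (hrh : rl < rh)
    (hC : C ∈ Icc (0 : ℝ) 1) {x y q : ℝ} (hy : 0 ≤ y)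
    (h : C * (min y m * rh + min x (m - min y m) * rl) ≤ min y (m - q) * rh + q * rl) :
    criticalLevel m rl rh C y ≤ max (m - x) 0 ∨ criticalLevel m rl rh C y ≤ m - q := by
  rcases le_total x (m - min y m) with hx | hx
  · exact Or.inl (le_max_of_le_left ((criticalLevel_le hm hrl hrh hC hy).trans (by linarith)))
  · rw [min_eq_right hx] at h
    have h1 : min y (m - q) * rh ≤ (m - q) * rh :=
      mul_le_mul_of_nonneg_right (min_le_right _ _) (hrl.trans hrh).le
    have h2 := criticalLevel_mul (m := m) (C := C) hrh y
    refine Or.inr (le_of_mul_le_mul_left ?_ (sub_pos.2 hrh))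
    linarith

/-- The conditions on a protection level function that involve only the points of a set `S`. -/
def localSet (m rl rh : ℝ) (R : Set (ℝ × ℝ)) (C : ℝ) (S : Set ℝ) : Set (ℝ → ℝ) :=
  univ.pi (fun _ => Icc 0 m) ∩
    {p | (∀ x ∈ S, ∀ x' ∈ S, 0 ≤ x → x ≤ x' → p x - (x' - x) ≤ p x' ∧ p x' ≤ p x) ∧
      (∀ x ∈ S, x ∈ Icc (xMin R) (xMax R) →
        p x ≤ m - max (forcedLow m rl rh C x (hLow R x)) 0) ∧
      ∀ x ∈ S, x ∈ Icc (xH m R) (xMax R) → criticalLevel m rl rh C (hUp R x) ≤ max (m - x) 0 ∨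
        criticalLevel m rl rh C (hUp R x) ≤ p x}

lemma isClosed_localSet (S : Set ℝ) : IsClosed (localSet m rl rh R C S) := by
  refine (isClosed_set_pi fun _ _ => isClosed_Icc).inter ?_
  simp only [ofPred_forall, ofPred_and, ofPred_or]
  refine IsClosed.inter ?_ (IsClosed.inter ?_ ?_)
  · exact isClosed_iInter fun x => isClosed_iInter fun _ => isClosed_iInter fun x' =>
      isClosed_iInter fun _ => isClosed_iInter fun _ => isClosed_iInter fun _ =>
      (isClosed_le (by fun_prop) (by fun_prop)).inter (isClosed_le (by fun_prop) (by fun_prop))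
  · exact isClosed_iInter fun x => isClosed_iInter fun _ => isClosed_iInter fun _ =>
      isClosed_le (by fun_prop) (by fun_prop)
  · exact isClosed_iInter fun x => isClosed_iInter fun _ => isClosed_iInter fun _ =>
      (isClosed_le (by fun_prop) (by fun_prop)).union (isClosed_le (by fun_prop) (by fun_prop))

lemma isCompact_localSet (S : Set ℝ) : IsCompact (localSet m rl rh R C S) :=
  (isCompact_univ_pi fun _ => isCompact_Icc).of_isClosed_subset (isClosed_localSet S)
    inter_subset_left

lemma localSet_anti {S T : Set ℝ} (h : S ⊆ T) :
    localSet m rl rh R C T ⊆ localSet m rl rh R C S := fun _ hp =>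
  ⟨hp.1, fun x hx x' hx' => hp.2.1 x (h hx) x' (h hx'), fun x hx => hp.2.2.1 x (h hx),
    fun x hx => hp.2.2.2 x (h hx)⟩

/-- Compactness: conditions that can be met on every finite set can be met simultaneously. -/
lemma exists_levelCompatible (h : ∀ F : Finset ℝ, (localSet m rl rh R C F).Nonempty) :
    ∃ p, ValidPL m (xMax R) p ∧ LevelCompatible m rl rh R C p := by
  classical
  obtain ⟨p, hp⟩ := IsCompact.nonempty_iInter_of_directed_nonempty_isCompact_isClosed
    (fun F : Finset ℝ => localSet m rl rh R C F)
    (fun F G => ⟨F ∪ G, localSet_anti (by simp), localSet_anti (by simp)⟩)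
    h (fun F => isCompact_localSet _) (fun F => isClosed_localSet _)
  have hp : ∀ F : Finset ℝ, p ∈ localSet m rl rh R C F := mem_iInter.1 hp
  refine ⟨p, validPL_of_mem_validSet ⟨(hp ∅).1, fun x hx x' hx' hxx => ?_⟩,
    fun x hx => ?_, fun x hx => ?_⟩
  · exact (hp {x, x'}).2.1 x (by simp) x' (by simp) hx.1 hxx
  · exact (hp {x}).2.2.1 x (by simp) hx
  · exact (hp {x}).2.2.2 x (by simp) hx

lemma consis_mem_feasibleRatios [IsProbabilityMeasure μ] (hne : R.Nonempty) (hconv : Convex ℝ R)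
    (hcomp : IsCompact R) (hquad : ∀ z ∈ R, 0 ≤ z.1 ∧ 0 ≤ z.2) (hm : 0 < m) (hrl : 0 < rl)
    (hrh : rl < rh) (A : RandomizedAlgorithm m Ω) (hC0 : 0 ≤ consis rl rh R μ A)
    (hC1 : consis rl rh R μ A ≤ 1) : consis rl rh R μ A ∈ feasibleRatios m rl rh R := by
  classical
  have hC : consis rl rh R μ A ∈ Icc (0 : ℝ) 1 := ⟨hC0, hC1⟩
  refine (mem_feasibleRatios_iff hne hconv hcomp hquad hm hrl hrh).2
    ⟨hC, exists_levelCompatible fun F => ?_⟩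
  -- Negative points of `F` carry no condition beyond the range [0, m].
  obtain ⟨J, hJ, hpre⟩ := exists_nested_low_sequences (F.filter (0 ≤ ·)) (by simp)
  have h0 := xMin_nonneg hne hquad
  have hkey : ∀ x ∈ F, 0 ≤ x → ∀ y, 0 ≤ y → (x, y) ∈ R →
      consis rl rh R μ A * (min y m * rh + min x (m - min y m) * rl) ≤
        min y (m - ∫ ω, (A.toAlg ω).total (J x) ∂μ) * rh +
          (∫ ω, (A.toAlg ω).total (J x) ∂μ) * rl := by
    intro x hx hx0 y hy hR
    obtain ⟨h1, h2⟩ := hJ x (by simp [hx, hx0])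
    have h := A.consis_mul_le (μ := μ) hm hrl hrh hC0 h1 hy (by rwa [h2])
    rwa [h2] at h
  refine ⟨fun x => m - ∫ ω, (A.toAlg ω).total (J x) ∂μ, fun x _ => ?_, fun x hx x' hx' hx0 hxx => ?_,
    fun x hx hxI => ?_, fun x hx hxI => ?_⟩
  · have := A.integral_total_mem (μ := μ) (J x)
    exact ⟨by linarith [this.2], by linarith [this.1]⟩
  · have hxF : x ∈ F.filter (0 ≤ ·) := Finset.mem_filter.2 ⟨hx, hx0⟩
    have hxF' : x' ∈ F.filter (0 ≤ ·) := Finset.mem_filter.2 ⟨hx', hx0.trans hxx⟩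
    obtain ⟨K, hK⟩ := hpre x hxF x' hxF' hxx
    have hKlow : AllLow K := fun r hr => (hJ x' hxF').1 r (hK ▸ List.mem_append_right _ hr)
    have hdem : lowDemand K = x' - x := by
      have := congrArg lowDemand hK
      rw [lowDemand_append, (hJ x hxF).2, (hJ x' hxF').2] at this
      linarith
    have := A.integral_total_append_mem (μ := μ) (J x) K hKlow
    rw [hK, hdem] at this
    exact ⟨by linarith [this.2], by linarith [this.1]⟩
  · have hR := hLow_mem hne hconv hcomp hxI
    have hq := (A.integral_total_mem (μ := μ) (J x)).1
    have := forcedLow_le_of_mul_le hrl hrh hq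
      (hkey x hx (h0.trans hxI.1) _ (hquad _ hR).2 hR)
    exact sub_le_sub_left (max_le this hq) m
  · have hxm := (xH_mem_Icc hcomp hne m).1.trans hxI.1
    have hR := hUp_mem hne hconv hcomp ⟨hxm, hxI.2⟩
    exact criticalLevel_le_of_mul_le hm hrl hrh hC (hquad _ hR).2
      (hkey x hx (h0.trans hxm) _ (hquad _ hR).2 hR)

/-- Provides a consistent sequence, without which the infimum could not be bounded by 1. -/
lemma exists_demand_eq {z : ℝ × ℝ} (hx : 0 ≤ z.1) (hy : 0 ≤ z.2) :
    ∃ I : List Request, (lowDemand I, highDemand I) = z := by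
  have h : ∀ (k : Kind) {s : ℝ}, 0 ≤ s → ∃ I : List Request, (∀ r ∈ I, r.kind = k) ∧
      (I.map Request.size).sum = s := by
    intro k s hs
    rcases eq_or_lt_of_le hs with rfl | hs
    · exact ⟨[], by simp, by simp⟩
    · exact ⟨[⟨s, k, hs⟩], by simp, by simp⟩
  obtain ⟨I, hI, hIx⟩ := h Kind.low hx
  obtain ⟨J, hJ, hJy⟩ := h Kind.high hy
  have h1 : lowDemand I = z.1 := by
    rw [← hIx, lowDemand]
    exact congrArg _ (List.map_congr_left fun r hr => by simp [Request.lowSize, hI r hr])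
  have h2 : highDemand J = z.2 := by
    rw [← hJy, highDemand]
    exact congrArg _ (List.map_congr_left fun r hr => by simp [Request.highSize, hJ r hr])
  have h3 : lowDemand J = 0 := by
    refine List.sum_eq_zero ?_
    simp only [List.mem_map, forall_exists_index, and_imp, forall_apply_eq_imp_iff₂]
    intro r hr
    simp [Request.lowSize, hJ r hr]
  have h4 : highDemand I = 0 := AllLow.highDemand_eq hI
  exact ⟨I ++ J, by rw [lowDemand_append, highDemand_append, h1, h2, h3, h4, add_zero, zero_add]⟩

end Expectation

theorem mainTheorem4 (m rl rh : ℝ) (hm : 0 < m) (hrl : 0 < rl) (hrh : rl < rh)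
    (R : Set (ℝ × ℝ)) (hne : R.Nonempty) (hconv : Convex ℝ R) (hcomp : IsCompact R)
    (hquad : ∀ z ∈ R, 0 ≤ z.1 ∧ 0 ≤ z.2) :
    IsGreatest (feasibleRatios m rl rh R) (Cstar m rl rh R) ∧
    (∀ (Ω : Type*) [MeasurableSpace Ω] (μ : Measure Ω) [IsProbabilityMeasure μ]
      (A : RandomizedAlgorithm m Ω), consis rl rh R μ A ≤ Cstar m rl rh R) ∧
    1 / (2 - rl / rh) ≤ Cstar m rl rh R := by
  have hρ := inv_two_sub_mem_feasibleRatios hne hconv hcomp hquad hm hrl hrh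
  have hgr : IsGreatest (feasibleRatios m rl rh R) (Cstar m rl rh R) :=
    (isCompact_feasibleRatios hne hconv hcomp hquad hm hrl hrh).isGreatest_sSup ⟨_, hρ⟩
  refine ⟨hgr, fun Ω _ μ _ A => ?_, hgr.2 hρ⟩
  rcases lt_or_ge (consis rl rh R μ A) 0 with h | h
  · exact h.le.trans hgr.1.1.1
  · obtain ⟨z, hz⟩ := hne
    obtain ⟨I, rfl⟩ := exists_demand_eq (hquad z hz).1 (hquad z hz).2
    have h1 := (A.consis_le_perfRatio (μ := μ) hrl hrh hz).trans
      (A.perfRatio_rew_mem hrl hrh I).2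
    exact hgr.2 (consis_mem_feasibleRatios ⟨_, hz⟩ hconv hcomp hquad hm hrl hrh A h h1)
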